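/- Let $d\ge 1$ and $r\ge 0$ be integers and consider the $d$-dimensional one-hidden-layer $\tanh$ tensor neural network $$\Upsilon(x)=\sum_{j=1}^r a_j\prod_{i=1}^d\tanh(w_{x_i,j}x_i+b_{x_i,j}),\qquad x\in\mathbb R^d,$$ with real parameters satisfying $a_j\ne 0$ and $b_{x_i,j}\neq 0$ for all $i,j$. Write $\mathcal F[u](k)$ for the value at $k$ of the Fourier transform (in the sense of distributions, $\mathcal F[u](k)=(2\pi)^{-d/2}\int u(x)e^{-\mathrm i k\cdot x}\,dx$) of a function $u$ whose transform is given by a continuous function near $k$. Let $\bm k^1,\bm k^2\in\mathbb R^d$ with $k^2_{x_i}>k^1_{x_i}>0$ for all $i$, and let $f:\mathbb R^d\to\mathbb R$ be a target function whose Fourier transform is given by a continuous function near $\bm k^1$ and near $\bm k^2$ (for instance, $f$ integrable). Put $D(\bm k)=\mathcal F[\Upsilon](\bm k)-\mathcal F[f](\bm k)$, $L(\bm k)=|D(\bm k)|^2$, and $\Theta_j=\{a_j,\,w_{x_i,j},\,b_{x_i,j}: i=1,\dots,d\}$, with elements $\Theta_{jl}$. Let $c_1,c_2>0$, and let $\mu$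 be Lebesgue measure. (i) Fix $j$ and fix all parameters except $w_{x_1,j},\dots,w_{x_d,j}$. If there is $\delta_0>0$ such that $|D(\bm k^1)|>c_1$ and $|D(\bm k^2)|<c_2$ whenever $0<|w_{x_i,j}|\le\delta_0$ for all $i$, then $$\lim_{\delta\to0^+}\frac{\mu\Big(\Big\{(|w_{x_1,j}|,\dots,|w_{x_d,j}|):\ \Big|\frac{\partial L(\bm k^1)}{\partial\Theta_{jl}}\Big|>\Big|\frac{\partial L(\bm k^2)}{\partial\Theta_{jl}}\Big|\ \text{for all } l\Big\}\cap(0,\delta]^d\Big)}{\delta^d}=1 .$$ (ii) Fix all parameters $a_j$ and $b_{x_i,j}$. If there is $\delta_0>0$ such that $|D(\bm k^1)|>c_1$ and $|D(\bm k^2)|<c_2$ whenever $0<|w_{x_i,j}|\le\delta_0$ for all $i$ and $j$, then $$\lim_{\delta\to0^+}\frac{\mu\Big(\Big\{(|w_{x_i,j}|)_{i,j}:\ \Big|\frac{\partial L(\bm k^1)}{\partial\Theta_{jl}}\Big|>\Big|\frac{\partial L(\bm k^2)}{\partial\Theta_{jl}}\Big|\ \text{for all } j,l\Big\}\cap(0,\delta]^{rd}\Big)}{\delta^{rd}}=1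 .$$ In both parts a vector of absolute values belongs to the set when, for every choice of the signs of the weights, all these partial derivatives exist and the inequalities hold. -/

import Mathlib

open MeasureTheory Filter Topology Set
open scoped ContDiff

/-- The parameters of a `d`-dimensional one-hidden-layer tensor neural network of rank `r`:
outer coefficients `a j`, inner weights `w j i` and biases `b j i`. -/
structure TNNParams (d r : ℕ) where
  a : Fin r → ℝ
  w : Fin r → Fin d → ℝ
  b : Fin r → Fin d → ℝ

/-- The labels of the parameters that belong to one neuron. -/
inductive ParamIndex (d : ℕ) where
  | a : ParamIndex d
  | w : Fin d → ParamIndex d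
  | b : Fin d → ParamIndex d

namespace TNNParams

variable {d r : ℕ}

/-- The network `x ↦ ∑ j, a j * ∏ i, tanh (w j i * x i + b j i)`. -/
noncomputable def eval (Θ : TNNParams d r) (x : Fin d → ℝ) : ℝ :=
  ∑ j, Θ.a j * ∏ i, Real.tanh (Θ.w j i * x i + Θ.b j i)

/-- The value of the parameter with label `l` of neuron `j`. -/
def get (Θ : TNNParams d r) (j : Fin r) : ParamIndex d → ℝ
  | .a => Θ.a j
  | .w i => Θ.w j i
  | .b i => Θ.b j i

/-- The parameter with label `l` of neuron `j` is replaced by `s`. -/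
def set (Θ : TNNParams d r) (j : Fin r) : ParamIndex d → ℝ → TNNParams d r
  | .a, s => { Θ with a := Function.update Θ.a j s }
  | .w i, s => { Θ with w := Function.update Θ.w j (Function.update (Θ.w j) i s) }
  | .b i, s => { Θ with b := Function.update Θ.b j (Function.update (Θ.b j) i s) }

/-- All inner weights are replaced by `w`. -/
def withWeights (Θ : TNNParams d r) (w : Fin r → Fin d → ℝ) : TNNParams d r :=
  { Θ with w := w }

/-- The inner weights of neuron `j` are replaced by `v`. -/
def withNeuronWeights (Θ : TNNParams d r) (j : Fin r) (v : Fin d → ℝ) : TNNParams d r :=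
  Θ.withWeights (Function.update Θ.w j v)

end TNNParams

/-- The Fourier transform `(2π)^(-d/2) ∫ φ(ξ) exp(-i ξ·x) dξ` of a test function. -/
noncomputable def testFourier {d : ℕ} (φ : (Fin d → ℝ) → ℂ) (x : Fin d → ℝ) : ℂ :=
  (((√(2 * Real.pi) ^ d)⁻¹ : ℝ) : ℂ) *
    ∫ ξ : Fin d → ℝ, φ ξ * Complex.exp (-(Complex.I * ((∑ i, ξ i * x i : ℝ) : ℂ)))

/-- The distributional Fourier transform `φ ↦ ∫ u(x) (F φ)(x) dx` of `u` is given by a continuous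
function on a neighbourhood of `k`, and `c` is the value of that function at `k`. -/
def HasFourierValue {d : ℕ} (u : (Fin d → ℝ) → ℝ) (k : Fin d → ℝ) (c : ℂ) : Prop :=
  ∃ U : Set (Fin d → ℝ), IsOpen U ∧ k ∈ U ∧ ∃ g : (Fin d → ℝ) → ℂ, ContinuousOn g U ∧ g k = c ∧
    ∀ φ : (Fin d → ℝ) → ℂ, ContDiff ℝ ∞ φ → HasCompactSupport φ → tsupport φ ⊆ U →
      Integrable (fun x => (u x : ℂ) * testFourier φ x) ∧
        ∫ x, (u x : ℂ) * testFourier φ x = ∫ ξ, g ξ * φ ξ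

open Classical in
/-- The value `F[u](k)` of the (distributional) Fourier transform of `u` at `k`; it is `0` if the
transform is not a continuous function near `k`. -/
noncomputable def fourierValue {d : ℕ} (u : (Fin d → ℝ) → ℝ) (k : Fin d → ℝ) : ℂ :=
  if h : ∃ c, HasFourierValue u k c then h.choose else 0

/-- The value is unique. -/
theorem HasFourierValue.unique {d : ℕ} {u : (Fin d → ℝ) → ℝ} {k : Fin d → ℝ} {c c' : ℂ}
    (h : HasFourierValue u k c) (h' : HasFourierValue u k c') : c = c' := by
  obtain ⟨U, hU, hkU, g, hg, rfl, H⟩ := h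
  obtain ⟨V, hV, hkV, g', hg', rfl, H'⟩ := h'
  have hW : IsOpen (U ∩ V) := hU.inter hV
  have hc : ContinuousOn (fun ξ => g ξ - g' ξ) (U ∩ V) :=
    (hg.mono inter_subset_left).sub (hg'.mono inter_subset_right)
  have key : ∀ᵐ ξ ∂(volume : Measure (Fin d → ℝ)), ξ ∈ U ∩ V → g ξ - g' ξ = 0 := by
    refine hW.ae_eq_zero_of_integral_contDiff_smul_eq_zero
      (hc.locallyIntegrableOn hW.measurableSet) ?_
    intro φ hφ hφc hφs
    have hψ : ContDiff ℝ ∞ (fun ξ => (φ ξ : ℂ)) := Complex.ofRealCLM.contDiff.comp hφ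
    have hsub : tsupport (fun ξ => (φ ξ : ℂ)) ⊆ tsupport φ :=
      closure_mono (fun ξ hξ => by
        simp only [Function.mem_support, ne_eq, Complex.ofReal_eq_zero] at hξ ⊢; exact hξ)
    have hψc : HasCompactSupport (fun ξ => (φ ξ : ℂ)) :=
      hφc.of_isClosed_subset (isClosed_tsupport _) hsub
    have hs := hsub.trans hφs
    have e := (H _ hψ hψc (hs.trans inter_subset_left)).2.symm.trans
      (H' _ hψ hψc (hs.trans inter_subset_right)).2
    have int : ∀ G : (Fin d → ℝ) → ℂ, ContinuousOn G (U ∩ V) →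
        Integrable (fun ξ => G ξ * (φ ξ : ℂ)) := by
      intro G hG
      have hK : IsCompact (tsupport (fun ξ => (φ ξ : ℂ))) := hψc
      have : IntegrableOn (fun ξ => G ξ * (φ ξ : ℂ)) (tsupport (fun ξ => (φ ξ : ℂ))) :=
        ((hG.mono hs).mul hψ.continuous.continuousOn).integrableOn_compact hK
      refine (integrableOn_iff_integrable_of_support_subset ?_).1 this
      intro ξ hξ
      refine subset_tsupport _ ?_
      simp only [Function.mem_support, ne_eq, mul_eq_zero, not_or] at hξ ⊢
      exact hξ.2
    calc ∫ ξ, φ ξ • (g ξ - g' ξ) = ∫ ξ, (g ξ * (φ ξ : ℂ) - g' ξ * (φ ξ : ℂ)) := by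
          congr 1; ext ξ; rw [Complex.real_smul]; ring
      _ = 0 := by
          rw [integral_sub (int g (hg.mono inter_subset_left))
            (int g' (hg'.mono inter_subset_right)), e, sub_self]
  have hne : ∃ᶠ ξ in 𝓝 k, g ξ - g' ξ = 0 := by
    intro hcon
    obtain ⟨N, hN, hNo, hkN⟩ := eventually_nhds_iff.1 hcon
    have hpos : 0 < volume (N ∩ (U ∩ V)) :=
      (hNo.inter hW).measure_pos volume ⟨k, hkN, hkU, hkV⟩
    refine hpos.ne' (measure_mono_null ?_ key)
    intro ξ hξ hz
    exact hN ξ hξ.1 (hz hξ.2)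
  have hck : ContinuousAt (fun ξ => g ξ - g' ξ) k := hc.continuousAt (hW.mem_nhds ⟨hkU, hkV⟩)
  have hz : g k - g' k = 0 := by
    by_contra hn
    exact hne (hck.eventually_ne hn)
  exact sub_eq_zero.1 hz

theorem HasFourierValue.fourierValue_eq {d : ℕ} {u : (Fin d → ℝ) → ℝ} {k : Fin d → ℝ} {c : ℂ}
    (h : HasFourierValue u k c) : fourierValue u k = c := by
  have hex : ∃ c, HasFourierValue u k c := ⟨c, h⟩
  rw [fourierValue, dif_pos hex]
  exact hex.choose_spec.unique h

/-- The spectral error `D(k) = F[Υ](k) - F[f](k)` of the network with parameters `Θ`. -/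
noncomputable def spectralError {d r : ℕ} (f : (Fin d → ℝ) → ℝ) (k : Fin d → ℝ)
    (Θ : TNNParams d r) : ℂ :=
  fourierValue Θ.eval k - fourierValue f k

/-- The loss `L(k) = |D(k)|^2` at the frequency `k`. -/
noncomputable def spectralLoss {d r : ℕ} (f : (Fin d → ℝ) → ℝ) (k : Fin d → ℝ)
    (Θ : TNNParams d r) : ℝ :=
  ‖spectralError f k Θ‖ ^ 2

/-- The partial derivative of `L(k)` with respect to the parameter `l` of neuron `j`. -/
noncomputable def partialLoss {d r : ℕ} (f : (Fin d → ℝ) → ℝ) (k : Fin d → ℝ)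
    (Θ : TNNParams d r) (j : Fin r) (l : ParamIndex d) : ℝ :=
  deriv (fun s => spectralLoss f k (Θ.set j l s)) (Θ.get j l)

/-- For every parameter of neuron `j`, the partial derivatives of `L(k₁)` and `L(k₂)` exist, and
that of `L(k₁)` is strictly larger in absolute value. -/
def GradientDominates {d r : ℕ} (f : (Fin d → ℝ) → ℝ) (k₁ k₂ : Fin d → ℝ)
    (Θ : TNNParams d r) (j : Fin r) : Prop :=
  ∀ l : ParamIndex d,
    DifferentiableAt ℝ (fun s => spectralLoss f k₁ (Θ.set j l s)) (Θ.get j l) ∧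
    DifferentiableAt ℝ (fun s => spectralLoss f k₂ (Θ.set j l s)) (Θ.get j l) ∧
    |partialLoss f k₁ Θ j l| > |partialLoss f k₂ Θ j l|

theorem exp_eq_sigmoid_div (y : ℝ) : Real.exp y = Real.sigmoid y / (1 - Real.sigmoid y) := by
  rw [← Real.sigmoid_neg, ← Real.sigmoid_mul_rexp_neg, Real.exp_neg]
  have := Real.sigmoid_pos y
  field_simp

theorem one_sub_sigmoid_pos (y : ℝ) : 0 < 1 - Real.sigmoid y := by
  linarith [Real.sigmoid_lt_one y]

/-- The characters of `ℝ` expressed through the sigmoid function. -/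
theorem sigmoid_cpow_mul (η y : ℝ) :
    (Real.sigmoid y : ℂ) ^ (1 - Complex.I * η - 1) * (1 - (Real.sigmoid y : ℂ)) ^
      (1 + Complex.I * η - 1) = Complex.exp (-(Complex.I * (η * y : ℝ))) := by
  have h1 := Real.sigmoid_pos y
  have h2 := one_sub_sigmoid_pos y
  have hy : y = Real.log (Real.sigmoid y) - Real.log (1 - Real.sigmoid y) := by
    rw [← Real.log_div h1.ne' h2.ne', ← exp_eq_sigmoid_div, Real.log_exp]
  have e : (1 - (Real.sigmoid y : ℂ)) = ((1 - Real.sigmoid y : ℝ) : ℂ) := by push_cast; rfl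
  rw [e, Complex.cpow_def_of_ne_zero (by exact_mod_cast h1.ne'),
    Complex.cpow_def_of_ne_zero (by exact_mod_cast h2.ne'), ← Complex.exp_add,
    ← Complex.ofReal_log h1.le, ← Complex.ofReal_log h2.le]
  congr 1
  conv_rhs => rw [hy]
  push_cast
  ring

theorem betaIntegral_conj_eq (η : ℝ) (hη : η ≠ 0) :
    Complex.betaIntegral (1 - Complex.I * η) (1 + Complex.I * η) =
      ((Real.pi * η / Real.sinh (Real.pi * η) : ℝ) : ℂ) := by
  have h := Complex.Gamma_mul_Gamma_eq_betaIntegral (s := 1 - Complex.I * η)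
    (t := 1 + Complex.I * η) (by simp) (by simp)
  have e : (1 - Complex.I * η) + (1 + Complex.I * η) = ((1 : ℕ) : ℂ) + 1 := by push_cast; ring
  have hne : (Complex.I * η : ℂ) ≠ 0 := by simp [hη]
  rw [e, Complex.Gamma_nat_eq_factorial, add_comm 1 (Complex.I * η : ℂ),
    Complex.Gamma_add_one _ hne] at h
  have h' : Complex.I * η * (Complex.Gamma (Complex.I * η) * Complex.Gamma (1 - Complex.I * η))
      = Complex.betaIntegral (1 - Complex.I * η) (Complex.I * η + 1) := by
    simp only [Nat.factorial_one, Nat.cast_one, one_mul] at h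
    rw [← h]; ring
  rw [add_comm 1 (Complex.I * η : ℂ), ← h', Complex.Gamma_mul_Gamma_one_sub]
  have hs : (Real.pi : ℂ) * (Complex.I * η) = (Real.pi * η : ℂ) * Complex.I := by ring
  rw [hs, Complex.sin_mul_I]
  have : Real.sinh (Real.pi * η) ≠ 0 := by
    rw [Ne, Real.sinh_eq_zero]; positivity
  have h3 : Complex.sinh (Real.pi * η : ℂ) ≠ 0 := by
    rw [← Complex.ofReal_mul, ← Complex.ofReal_sinh]; exact_mod_cast this
  push_cast
  field_simp

theorem sigmoid_deriv_change (η : ℝ) :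
    Integrable (fun y : ℝ => ((Real.sigmoid y * (1 - Real.sigmoid y) : ℝ) : ℂ) *
        Complex.exp (-(Complex.I * (η * y : ℝ)))) ∧
      ∫ y : ℝ, ((Real.sigmoid y * (1 - Real.sigmoid y) : ℝ) : ℂ) *
        Complex.exp (-(Complex.I * (η * y : ℝ))) =
      Complex.betaIntegral (1 - Complex.I * η) (1 + Complex.I * η) := by
  have hd : ∀ x ∈ (univ : Set ℝ), HasDerivWithinAt Real.sigmoid
      (Real.sigmoid x * (1 - Real.sigmoid x)) univ x := fun x _ =>
    (Real.hasDerivAt_sigmoid x).hasDerivWithinAt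
  have hinj : InjOn Real.sigmoid univ := Real.sigmoid_injective.injOn
  let g : ℝ → ℂ := fun x => (x : ℂ) ^ (1 - Complex.I * η - 1) * (1 - (x : ℂ)) ^
    (1 + Complex.I * η - 1)
  have hg : ∀ y : ℝ, |Real.sigmoid y * (1 - Real.sigmoid y)| • g (Real.sigmoid y) =
      ((Real.sigmoid y * (1 - Real.sigmoid y) : ℝ) : ℂ) *
        Complex.exp (-(Complex.I * (η * y : ℝ))) := by
    intro y
    rw [abs_of_pos (mul_pos (Real.sigmoid_pos y) (one_sub_sigmoid_pos y)), Complex.real_smul]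
    simp only [g]
    rw [sigmoid_cpow_mul]
  have hint := Complex.betaIntegral_convergent (u := 1 - Complex.I * η)
    (v := 1 + Complex.I * η) (by simp) (by simp)
  rw [intervalIntegrable_iff_integrableOn_Ioo_of_le zero_le_one] at hint
  constructor
  · have h := (integrableOn_image_iff_integrableOn_abs_deriv_smul MeasurableSet.univ hd hinj g).1
      (by rw [image_univ, Real.range_sigmoid]; exact hint)
    simp only [hg, integrableOn_univ] at h
    exact h
  · have h := integral_image_eq_integral_abs_deriv_smul MeasurableSet.univ hd hinj g
    simp only [hg, image_univ, Real.range_sigmoid, setIntegral_univ] at h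
    rw [← h, Complex.betaIntegral, intervalIntegral.integral_of_le zero_le_one,
      integral_Ioc_eq_integral_Ioo]

theorem integrable_sigmoid_deriv :
    Integrable (fun y : ℝ => Real.sigmoid y * (1 - Real.sigmoid y)) := by
  have h := (sigmoid_deriv_change 0).1.re
  refine h.congr (Eventually.of_forall fun y => ?_)
  simp [-Complex.ofReal_mul]

theorem sigmoid_sub_bound (y c : ℝ) :
    ‖Real.sigmoid y - Real.sigmoid (y - c)‖ ≤
      |Real.exp c - 1| * (1 + Real.exp (-c)) * (Real.sigmoid y * (1 - Real.sigmoid y)) := by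
  have h1 : Real.sigmoid y - Real.sigmoid (y - c) =
      (Real.exp c - 1) * ((1 - Real.sigmoid y) * Real.sigmoid (y - c)) := by
    simp only [Real.sigmoid_def, neg_sub]
    rw [show c - y = c + -y by ring, Real.exp_add]
    have := Real.exp_pos (-y)
    have := Real.exp_pos c
    field_simp
    ring
  have h2 : Real.sigmoid (y - c) ≤ (1 + Real.exp (-c)) * Real.sigmoid y := by
    simp only [Real.sigmoid_def, neg_sub]
    rw [show c - y = c + -y by ring, Real.exp_add, Real.exp_neg c]
    have := Real.exp_pos (-y)
    have := Real.exp_pos c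
    rw [inv_le_iff_one_le_mul₀ (by positivity)]
    field_simp
    nlinarith [mul_pos this (Real.exp_pos (-y))]
  rw [h1, norm_mul, Real.norm_eq_abs, mul_assoc, Real.norm_eq_abs, abs_of_pos
    (mul_pos (one_sub_sigmoid_pos y) (Real.sigmoid_pos _))]
  refine mul_le_mul_of_nonneg_left ?_ (abs_nonneg _)
  nlinarith [one_sub_sigmoid_pos y]

theorem tanh_eq_sigmoid (x : ℝ) : Real.tanh x = 2 * Real.sigmoid (2 * x) - 1 := by
  rw [Real.tanh_eq_sinh_div_cosh, Real.sinh_eq, Real.cosh_eq, Real.sigmoid_def,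
    show -(2 * x) = -x + -x by ring, Real.exp_add, Real.exp_neg]
  have := Real.exp_pos x
  field_simp
  ring

/-- `√(2π)` times the Fourier transform of `x ↦ tanh (w * x + b)` at `ξ ≠ 0`. -/
noncomputable def tanhFourier (w b ξ : ℝ) : ℂ :=
  -(Complex.I * Real.pi) * (w : ℂ)⁻¹ * Complex.exp (Complex.I * (b * ξ / w : ℝ)) /
    (Real.sinh (Real.pi * ξ / (2 * |w|)) : ℝ)

/-- The difference of `x ↦ tanh (w * x + b)` and its translate by `h`. -/
noncomputable def tanhDiff (w b h x : ℝ) : ℝ :=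
  Real.tanh (w * x + b) - Real.tanh (w * (x - h) + b)

theorem tanhDiff_eq_sigmoid (w b h x : ℝ) :
    tanhDiff w b h x =
      2 * (Real.sigmoid (2 * w * x + 2 * b) - Real.sigmoid (2 * w * x + (2 * b - 2 * w * h))) := by
  rw [tanhDiff, tanh_eq_sigmoid, tanh_eq_sigmoid]
  ring_nf

theorem integrable_tanhDiff (w b h : ℝ) : Integrable (tanhDiff w b h) := by
  rcases eq_or_ne w 0 with rfl | hw
  · simp [show tanhDiff 0 b h = fun _ => 0 by ext; simp [tanhDiff]]
  have hi := ((integrable_sigmoid_deriv.comp_add_right (2 * b)).comp_mul_left'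
    (mul_ne_zero two_ne_zero hw)).const_mul
      (2 * (|Real.exp (2 * w * h) - 1| * (1 + Real.exp (-(2 * w * h)))))
  have hc : Continuous (tanhDiff w b h) := by
    simp only [funext (tanhDiff_eq_sigmoid w b h)]
    fun_prop
  refine hi.mono' hc.aestronglyMeasurable (Eventually.of_forall fun x => ?_)
  rw [tanhDiff_eq_sigmoid, norm_mul]
  have := sigmoid_sub_bound (2 * w * x + 2 * b) (2 * w * h)
  rw [show 2 * w * x + (2 * b - 2 * w * h) = 2 * w * x + 2 * b - 2 * w * h by ring]
  simp only [Real.norm_ofNat]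
  linarith

theorem sigmoid_deriv_affine (p q ξ : ℝ) (hp : p ≠ 0) (hξ : ξ ≠ 0) :
    Integrable (fun x : ℝ => ((Real.sigmoid (p * x + q) * (1 - Real.sigmoid (p * x + q)) : ℝ) : ℂ) *
        Complex.exp (-(Complex.I * (ξ * x : ℝ)))) ∧
      ∫ x : ℝ, ((Real.sigmoid (p * x + q) * (1 - Real.sigmoid (p * x + q)) : ℝ) : ℂ) *
        Complex.exp (-(Complex.I * (ξ * x : ℝ))) =
      Complex.exp (Complex.I * (ξ * q / p : ℝ)) *
        ((|p|⁻¹ * (Real.pi * (ξ / p) / Real.sinh (Real.pi * (ξ / p))) : ℝ) : ℂ) := by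
  obtain ⟨h1, h2⟩ := sigmoid_deriv_change (ξ / p)
  rw [betaIntegral_conj_eq _ (div_ne_zero hξ hp)] at h2
  set F : ℝ → ℂ := fun y : ℝ => ((Real.sigmoid y * (1 - Real.sigmoid y) : ℝ) : ℂ) *
    Complex.exp (-(Complex.I * (ξ / p * y : ℝ))) with hF
  have e : (fun x : ℝ => ((Real.sigmoid (p * x + q) * (1 - Real.sigmoid (p * x + q)) : ℝ) : ℂ) *
      Complex.exp (-(Complex.I * (ξ * x : ℝ)))) =
      fun x => Complex.exp (Complex.I * (ξ * q / p : ℝ)) * F (p * x + q) := by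
    ext x
    rw [hF]
    simp only
    rw [mul_left_comm, ← Complex.exp_add]
    congr 2
    have hp' : (p : ℂ) ≠ 0 := by exact_mod_cast hp
    push_cast
    field_simp
    ring
  rw [e]
  refine ⟨((h1.comp_add_right q).comp_mul_left' hp).const_mul _, ?_⟩
  rw [integral_const_mul, Measure.integral_comp_mul_left (fun y => F (y + q)) p,
    integral_add_right_eq_self F q, h2, abs_inv, Complex.real_smul]
  push_cast
  rfl

theorem inv_abs_div_sinh (w c : ℝ) :
    |w|⁻¹ / Real.sinh (c / w) = w⁻¹ / Real.sinh (c / |w|) := by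
  rcases abs_choice w with h | h
  · rw [h]
  · rw [h, div_neg, Real.sinh_neg, inv_neg, div_neg, neg_div]

theorem integral_tanhDiff_mul_exp (w b h ξ : ℝ) (hξ : ξ ≠ 0) :
    ∫ x : ℝ, (tanhDiff w b h x : ℂ) * Complex.exp (-(Complex.I * (ξ * x : ℝ))) =
      (1 - Complex.exp (-(Complex.I * (ξ * h : ℝ)))) * tanhFourier w b ξ := by
  rcases eq_or_ne w 0 with rfl | hw
  · simp [tanhDiff, tanhFourier]
  have hp : 2 * w ≠ 0 := mul_ne_zero two_ne_zero hw
  obtain ⟨i1, e1⟩ := sigmoid_deriv_affine (2 * w) (2 * b) ξ hp hξ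
  obtain ⟨i2, e2⟩ := sigmoid_deriv_affine (2 * w) (2 * b - 2 * w * h) ξ hp hξ
  set A : ℝ → ℂ := fun x : ℝ => ((Real.sigmoid (2 * w * x + 2 * b) *
    (1 - Real.sigmoid (2 * w * x + 2 * b)) : ℝ) : ℂ) with hA
  set B : ℝ → ℂ := fun x : ℝ => ((Real.sigmoid (2 * w * x + (2 * b - 2 * w * h)) *
    (1 - Real.sigmoid (2 * w * x + (2 * b - 2 * w * h))) : ℝ) : ℂ) with hB
  have hu : ∀ x, HasDerivAt (fun x => (tanhDiff w b h x : ℂ)) (4 * w * (A x - B x)) x := by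
    intro x
    have l : ∀ q, HasDerivAt (fun x : ℝ => 2 * w * x + q) (2 * w) x := fun q => by
      simpa using ((hasDerivAt_id x).const_mul (2 * w)).add_const q
    have h1 := (Real.hasDerivAt_sigmoid (2 * w * x + 2 * b)).comp x (l (2 * b))
    have h2 := (Real.hasDerivAt_sigmoid (2 * w * x + (2 * b - 2 * w * h))).comp x
      (l (2 * b - 2 * w * h))
    have h3 := ((h1.sub h2).const_mul 2).ofReal_comp
    simp only [tanhDiff_eq_sigmoid]
    refine h3.congr_deriv ?_
    simp only [hA, hB]
    push_cast
    ring
  have hv : ∀ x : ℝ, HasDerivAt (fun x : ℝ => Complex.exp (-(Complex.I * (ξ * x : ℝ))))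
      (-(Complex.I * ξ) * Complex.exp (-(Complex.I * (ξ * x : ℝ)))) x := by
    intro x
    have h1 : HasDerivAt (fun x : ℝ => -(Complex.I * ((ξ * x : ℝ) : ℂ))) (-(Complex.I * ξ)) x := by
      have := (((hasDerivAt_id x).const_mul ξ).ofReal_comp.const_mul Complex.I).neg
      simpa [Function.comp_def, Pi.neg_def] using this
    simpa [mul_comm] using h1.cexp
  have hnorm : ∀ x : ℝ, ‖Complex.exp (-(Complex.I * (ξ * x : ℝ)))‖ = 1 := fun x => by
    rw [show -(Complex.I * ((ξ * x : ℝ) : ℂ)) = ((-(ξ * x) : ℝ) : ℂ) * Complex.I by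
      push_cast; ring, Complex.norm_exp_ofReal_mul_I]
  have hcont : Continuous (fun x : ℝ => Complex.exp (-(Complex.I * (ξ * x : ℝ)))) := by fun_prop
  have huv : Integrable (fun x => (tanhDiff w b h x : ℂ) *
      Complex.exp (-(Complex.I * (ξ * x : ℝ)))) := by
    refine (integrable_tanhDiff w b h).ofReal.mul_bdd (c := 1) hcont.aestronglyMeasurable
      (Eventually.of_forall fun x => (hnorm x).le)
  have hbp := integral_mul_deriv_eq_deriv_mul_of_integrable
    (u := fun x => (tanhDiff w b h x : ℂ)) (fun x _ => hu x) (fun x _ => hv x)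
    (by
      refine (huv.const_mul (-(Complex.I * ξ))).congr (Eventually.of_forall fun x => ?_)
      simp only [Pi.mul_apply]; ring)
    (by
      refine ((i1.sub i2).const_mul (4 * w)).congr (Eventually.of_forall fun x => ?_)
      simp only [Pi.mul_apply, Pi.sub_apply]; ring)
    huv
  have r1 : ∫ x : ℝ, (tanhDiff w b h x : ℂ) *
      (-(Complex.I * ξ) * Complex.exp (-(Complex.I * (ξ * x : ℝ)))) =
      -(Complex.I * ξ) * ∫ x : ℝ, (tanhDiff w b h x : ℂ) *
        Complex.exp (-(Complex.I * (ξ * x : ℝ))) := by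
    rw [← integral_const_mul]; congr 1; ext x; ring
  have r2 : ∫ x : ℝ, 4 * w * (A x - B x) * Complex.exp (-(Complex.I * (ξ * x : ℝ))) =
      4 * w * ((∫ x : ℝ, A x * Complex.exp (-(Complex.I * (ξ * x : ℝ)))) -
        ∫ x : ℝ, B x * Complex.exp (-(Complex.I * (ξ * x : ℝ)))) := by
    rw [← integral_sub i1 i2, ← integral_const_mul]; congr 1; ext x; ring
  rw [r1, r2, e1, e2] at hbp
  have hξ' : (ξ : ℂ) ≠ 0 := by exact_mod_cast hξ
  have hw' : (w : ℂ) ≠ 0 := by exact_mod_cast hw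
  have hI : -(Complex.I * ξ) ≠ 0 := by simp [hξ]
  apply mul_left_cancel₀ hI
  rw [hbp]
  have ex : Complex.exp (Complex.I * ((ξ * (2 * b - 2 * w * h) / (2 * w) : ℝ) : ℂ)) =
      Complex.exp (Complex.I * (b * ξ / w : ℝ)) *
        Complex.exp (-(Complex.I * (ξ * h : ℝ))) := by
    rw [← Complex.exp_add]; congr 1; push_cast; field_simp; ring
  have ex' : ((ξ * (2 * b) / (2 * w) : ℝ) : ℂ) = (b * ξ / w : ℝ) := by
    push_cast; field_simp
  have key : |2 * w|⁻¹ * (Real.pi * (ξ / (2 * w)) / Real.sinh (Real.pi * (ξ / (2 * w)))) =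
      Real.pi * ξ / (4 * w) * (w⁻¹ / Real.sinh (Real.pi * ξ / (2 * |w|))) := by
    have := inv_abs_div_sinh (2 * w) (Real.pi * ξ)
    rw [abs_mul, abs_two] at this ⊢
    have e3 : w⁻¹ / Real.sinh (Real.pi * ξ / (2 * |w|)) = 2 * ((2 * w)⁻¹ /
      Real.sinh (Real.pi * ξ / (2 * |w|))) := by
        rw [mul_inv]; ring
    rw [e3, ← this, ← mul_div_assoc Real.pi]
    ring
  rw [ex, ex', key, tanhFourier]
  push_cast
  field_simp
  ring_nf
  simp
  try ring

theorem norm_exp_neg_I_mul (y : ℝ) : ‖Complex.exp (-(Complex.I * (y : ℂ)))‖ = 1 := by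
  rw [show -(Complex.I * (y : ℂ)) = ((-y : ℝ) : ℂ) * Complex.I by push_cast; ring,
    Complex.norm_exp_ofReal_mul_I]

/-- The Fourier transform of a test function is integrable. -/
theorem integrable_testFourier {d : ℕ} {φ : (Fin d → ℝ) → ℂ} (hφ : ContDiff ℝ ∞ φ)
    (hc : HasCompactSupport φ) : Integrable (testFourier φ) := by
  let e := EuclideanSpace.equiv (Fin d) ℝ
  have hs : ContDiff ℝ ∞ (φ ∘ e) := hφ.comp e.contDiff
  have hcs : HasCompactSupport (φ ∘ e) := hc.comp_homeomorph e.toHomeomorph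
  let S := hcs.toSchwartzMap hs
  have h1 : Integrable (FourierTransform.fourier (φ ∘ e)) := by
    have := (FourierTransform.fourier S).integrable (μ := volume)
    rwa [SchwartzMap.fourier_coe] at this
  have h2 := ((PiLp.volume_preserving_toLp (Fin d)).integrable_comp_emb
    (MeasurableEquiv.toLp 2 (Fin d → ℝ)).measurableEmbedding).2 h1
  have h3 := (h2.comp_smul (R := (2 * Real.pi)⁻¹) (by positivity)).const_mul
    (((√(2 * Real.pi) ^ d)⁻¹ : ℝ) : ℂ)
  refine h3.congr (Eventually.of_forall fun x => ?_)
  simp only [Function.comp_apply, testFourier]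
  congr 1
  rw [Real.fourier_eq', ← (PiLp.volume_preserving_toLp (Fin d)).integral_comp
    (MeasurableEquiv.toLp 2 (Fin d → ℝ)).measurableEmbedding]
  congr 1
  ext ξ
  rw [smul_eq_mul, mul_comm]
  congr 2
  rw [PiLp.inner_apply]
  simp only [Pi.smul_apply, smul_eq_mul, RCLike.inner_apply, conj_trivial]
  have : ∑ i, (2 * Real.pi)⁻¹ * x i * ξ i = (2 * Real.pi)⁻¹ * ∑ i, ξ i * x i := by
    rw [Finset.mul_sum]; exact Finset.sum_congr rfl fun i _ => by ring
  rw [this, show -2 * Real.pi * ((2 * Real.pi)⁻¹ * ∑ i, ξ i * x i) = -∑ i, ξ i * x i by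
    field_simp]
  push_cast
  ring

/-- The exponential factor that implements the translation by `h` in the coordinates in `t`. -/
theorem prod_exp_eq {d : ℕ} (h : ℝ) (t : Finset (Fin d)) (ξ : Fin d → ℝ) :
    ∏ i ∈ t, Complex.exp (-(Complex.I * (ξ i * h : ℝ))) =
      Complex.exp (-(Complex.I * ((∑ i, ξ i * (if i ∈ t then h else 0) : ℝ) : ℂ))) := by
  rw [← Complex.exp_sum]
  congr 1
  rw [Finset.sum_neg_distrib, ← Finset.mul_sum]
  simp

theorem integrable_testFunction_mul_exp {d : ℕ} {ψ : (Fin d → ℝ) → ℂ} (hψ : Continuous ψ)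
    (hc : HasCompactSupport ψ) (x : Fin d → ℝ) :
    Integrable (fun ξ => ψ ξ * Complex.exp (-(Complex.I * ((∑ i, ξ i * x i : ℝ) : ℂ)))) := by
  refine Integrable.mul_bdd (c := 1) (hψ.integrable_of_hasCompactSupport hc)
    (Continuous.aestronglyMeasurable (by fun_prop))
    (Eventually.of_forall fun ξ => (norm_exp_neg_I_mul _).le)

theorem testFourier_mul_prod {d : ℕ} {ψ : (Fin d → ℝ) → ℂ} (hψ : Continuous ψ)
    (hc : HasCompactSupport ψ) (h : ℝ) (x : Fin d → ℝ) :
    testFourier (fun ξ => ψ ξ * ∏ i, (1 - Complex.exp (-(Complex.I * (ξ i * h : ℝ))))) x =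
      ∑ t : Finset (Fin d), (-1) ^ t.card * testFourier ψ
        (x + fun i => if i ∈ t then h else 0) := by
  have e : ∀ ξ : Fin d → ℝ, ψ ξ * (∏ i, (1 - Complex.exp (-(Complex.I * (ξ i * h : ℝ))))) *
      Complex.exp (-(Complex.I * ((∑ i, ξ i * x i : ℝ) : ℂ))) =
      ∑ t : Finset (Fin d), (-1) ^ t.card * (ψ ξ * Complex.exp (-(Complex.I *
        ((∑ i, ξ i * (x + fun i => if i ∈ t then h else 0) i : ℝ) : ℂ)))) := by
    intro ξ
    rw [Finset.prod_sub, Finset.powerset_univ, Finset.mul_sum, Finset.sum_mul]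
    refine Finset.sum_congr rfl fun t _ => ?_
    rw [prod_exp_eq, Finset.prod_const_one]
    have : Complex.exp (-(Complex.I *
        ((∑ i, ξ i * (x + fun i => if i ∈ t then h else 0) i : ℝ) : ℂ))) =
        Complex.exp (-(Complex.I * ((∑ i, ξ i * (if i ∈ t then h else 0) : ℝ) : ℂ))) *
        Complex.exp (-(Complex.I * ((∑ i, ξ i * x i : ℝ) : ℂ))) := by
      rw [← Complex.exp_add]
      congr 1
      simp only [Pi.add_apply, mul_add, Finset.sum_add_distrib]
      push_cast
      ring
    rw [this]
    ring
  simp only [testFourier, e]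
  rw [integral_finsetSum _ fun t _ => (integrable_testFunction_mul_exp hψ hc _).const_mul _,
    Finset.mul_sum]
  refine Finset.sum_congr rfl fun t _ => ?_
  rw [integral_const_mul]
  ring

theorem abs_tanh_le_one (y : ℝ) : |Real.tanh y| ≤ 1 := by
  rw [tanh_eq_sigmoid, abs_le]
  constructor <;> linarith [Real.sigmoid_pos (2 * y), Real.sigmoid_lt_one (2 * y)]

theorem continuous_tanh : Continuous Real.tanh := by
  simp only [funext tanh_eq_sigmoid]
  fun_prop

theorem integrable_tanhProd_mul {d : ℕ} (w b : Fin d → ℝ) {F : (Fin d → ℝ) → ℂ}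
    (hF : Integrable F) :
    Integrable (fun x => ((∏ i, Real.tanh (w i * x i + b i) : ℝ) : ℂ) * F x) := by
  have hc : Continuous fun x : Fin d → ℝ => ((∏ i, Real.tanh (w i * x i + b i) : ℝ) : ℂ) := by
    have := continuous_tanh
    fun_prop
  refine hF.bdd_mul (c := 1) hc.aestronglyMeasurable (Eventually.of_forall fun x => ?_)
  rw [Complex.norm_real, Real.norm_eq_abs, Finset.abs_prod]
  exact Finset.prod_le_one (fun _ _ => abs_nonneg _) fun _ _ => abs_tanh_le_one _

/-- Translations turn the product of hyperbolic tangents into a product of differences. -/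
theorem integral_tanhProd_mul_testFourier {d : ℕ} (w b : Fin d → ℝ) {ψ : (Fin d → ℝ) → ℂ}
    (hψ : ContDiff ℝ ∞ ψ) (hc : HasCompactSupport ψ) (h : ℝ) :
    ∫ x : Fin d → ℝ, ((∏ i, Real.tanh (w i * x i + b i) : ℝ) : ℂ) *
      testFourier (fun ξ => ψ ξ * ∏ i, (1 - Complex.exp (-(Complex.I * (ξ i * h : ℝ))))) x =
    ∫ x : Fin d → ℝ, (∏ i, (tanhDiff (w i) (b i) h (x i) : ℂ)) * testFourier ψ x := by
  have hψi := integrable_testFourier hψ hc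
  let s : Finset (Fin d) → Fin d → ℝ := fun t i => if i ∈ t then h else 0
  let u : (Fin d → ℝ) → ℂ := fun x => ((∏ i, Real.tanh (w i * x i + b i) : ℝ) : ℂ)
  have hu : ∀ t, Integrable (fun x => u x * testFourier ψ (x + s t)) := fun t =>
    integrable_tanhProd_mul w b (hψi.comp_add_right (s t))
  have htr : ∀ t, (fun x => u x * testFourier ψ (x + s t)) =
      fun x => (fun y => u (y - s t) * testFourier ψ y) (x + s t) := fun t => by
    ext x; simp
  have hu' : ∀ t, Integrable (fun y => u (y - s t) * testFourier ψ y) := fun t => by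
    simpa using (hu t).comp_sub_right (s t)
  calc _ = ∫ x, ∑ t : Finset (Fin d), (-1) ^ t.card * (u x * testFourier ψ (x + s t)) := by
        congr 1
        ext x
        rw [testFourier_mul_prod hψ.continuous hc, Finset.mul_sum]
        exact Finset.sum_congr rfl fun t _ => by simp only [u, s]; ring
    _ = ∑ t : Finset (Fin d), (-1) ^ t.card * ∫ y, u (y - s t) * testFourier ψ y := by
        rw [integral_finsetSum _ fun t _ => (hu t).const_mul _]
        refine Finset.sum_congr rfl fun t _ => ?_
        rw [integral_const_mul, htr, integral_add_right_eq_self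
          (fun y => u (y - s t) * testFourier ψ y)]
    _ = ∫ x, ∑ t : Finset (Fin d), (-1) ^ t.card * (u (x - s t) * testFourier ψ x) := by
        rw [integral_finsetSum _ fun t _ => (hu' t).const_mul _]
        exact Finset.sum_congr rfl fun t _ => (integral_const_mul _ _).symm
    _ = _ := by
        congr 1
        ext x
        simp only [tanhDiff, Complex.ofReal_sub]
        rw [Finset.prod_sub, Finset.powerset_univ, Finset.sum_mul]
        refine Finset.sum_congr rfl fun t _ => ?_
        have : u (x - s t) = (∏ i ∈ Finset.univ \ t, (Real.tanh (w i * x i + b i) : ℂ)) *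
            ∏ i ∈ t, (Real.tanh (w i * (x i - h) + b i) : ℂ) := by
          simp only [u, Complex.ofReal_prod]
          rw [← Finset.prod_sdiff (Finset.subset_univ t)]
          congr 1
          · refine Finset.prod_congr rfl fun i hi => ?_
            simp only [Finset.mem_sdiff, Finset.mem_univ, true_and] at hi
            simp [s, hi]
          · exact Finset.prod_congr rfl fun i hi => by simp [s, hi]
        rw [this]
        ring

theorem integral_mul_testFourier {d : ℕ} {V : (Fin d → ℝ) → ℂ} (hV : Integrable V)
    {ψ : (Fin d → ℝ) → ℂ} (hψ : Continuous ψ) (hc : HasCompactSupport ψ) :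
    ∫ x, V x * testFourier ψ x = ∫ ξ : Fin d → ℝ, (((√(2 * Real.pi) ^ d)⁻¹ : ℝ) : ℂ) *
      (∫ x, V x * Complex.exp (-(Complex.I * ((∑ i, ξ i * x i : ℝ) : ℂ)))) * ψ ξ := by
  have hi : Integrable (Function.uncurry fun (x ξ : Fin d → ℝ) => V x * ψ ξ *
      Complex.exp (-(Complex.I * ((∑ i, ξ i * x i : ℝ) : ℂ)))) (volume.prod volume) := by
    refine Integrable.mul_bdd (c := 1)
      (hV.mul_prod (hψ.integrable_of_hasCompactSupport hc)) ?_
      (Eventually.of_forall fun p => (norm_exp_neg_I_mul _).le)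
    exact Continuous.aestronglyMeasurable (by fun_prop)
  calc _ = (((√(2 * Real.pi) ^ d)⁻¹ : ℝ) : ℂ) * ∫ x, ∫ ξ, V x * ψ ξ *
        Complex.exp (-(Complex.I * ((∑ i, ξ i * x i : ℝ) : ℂ))) := by
        rw [← integral_const_mul]
        congr 1
        ext x
        rw [testFourier, mul_left_comm, ← integral_const_mul]
        simp only [mul_assoc]
    _ = _ := by
        rw [integral_integral_swap hi, ← integral_const_mul]
        congr 1
        ext ξ
        rw [mul_assoc, ← integral_mul_const]
        congr 2
        ext x
        ring

theorem integral_prod_mul_exp {d : ℕ} (v : Fin d → ℝ → ℂ) (ξ : Fin d → ℝ) :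
    ∫ x : Fin d → ℝ, (∏ i, v i (x i)) *
      Complex.exp (-(Complex.I * ((∑ i, ξ i * x i : ℝ) : ℂ))) =
    ∏ i, ∫ x : ℝ, v i x * Complex.exp (-(Complex.I * (ξ i * x : ℝ))) := by
  rw [← integral_fintype_prod_volume_eq_prod]
  congr 1
  ext x
  rw [Finset.prod_mul_distrib, ← Complex.exp_sum]
  congr 2
  rw [Finset.sum_neg_distrib, ← Finset.mul_sum]
  push_cast
  rfl

theorem continuousOn_tanhFourier (w b : ℝ) : ContinuousOn (tanhFourier w b) (Ioi 0) := by
  rcases eq_or_ne w 0 with rfl | hw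
  · rw [show tanhFourier 0 b = fun _ => 0 by ext; simp [tanhFourier]]
    exact continuousOn_const
  · unfold tanhFourier
    refine ContinuousOn.div (by fun_prop) ?_ ?_
    · have := Real.continuous_sinh
      fun_prop
    · intro ξ hξ
      have h1 : 0 < ξ := hξ
      have : 0 < Real.pi * ξ / (2 * |w|) := by positivity
      exact_mod_cast (Real.sinh_pos_iff.2 this).ne'

/-- The Fourier transform of `x ↦ ∏ i, tanh (w i * x i + b i)` off the coordinate hyperplanes. -/
noncomputable def tanhProdFourier {d : ℕ} (w b ξ : Fin d → ℝ) : ℂ :=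
  (((√(2 * Real.pi) ^ d)⁻¹ : ℝ) : ℂ) * ∏ i, tanhFourier (w i) (b i) (ξ i)

theorem one_sub_exp_ne_zero {y : ℝ} (h0 : 0 < y) (h1 : y < 1) :
    1 - Complex.exp (-(Complex.I * (y : ℂ))) ≠ 0 := by
  intro h
  have h2 := congrArg Complex.im h
  have : -(Complex.I * (y : ℂ)) = ((-y : ℝ) : ℂ) * Complex.I := by push_cast; ring
  rw [this, Complex.sub_im, Complex.exp_ofReal_mul_I_im] at h2
  have := Real.sin_pos_of_pos_of_lt_pi h0 (by linarith [Real.pi_gt_three])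
  simp at h2
  linarith

theorem contDiff_div_of_tsupport {E : Type*} [NormedAddCommGroup E] [NormedSpace ℝ E]
    {φ g : E → ℂ} {n : WithTop ℕ∞} (hφ : ContDiff ℝ n φ) (hg : ContDiff ℝ n g)
    (h : ∀ x ∈ tsupport φ, g x ≠ 0) : ContDiff ℝ n (fun x => φ x / g x) := by
  rw [contDiff_iff_contDiffAt]
  intro x
  by_cases hx : x ∈ tsupport φ
  · simp only [div_eq_mul_inv]
    exact hφ.contDiffAt.mul (hg.contDiffAt.inv (h x hx))
  · refine (contDiffAt_const (c := (0 : ℂ))).congr_of_eventuallyEq ?_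
    filter_upwards [notMem_tsupport_iff_eventuallyEq.1 hx] with y hy
    simp [hy]

theorem integral_tanhProd_mul_testFourier_eq {d : ℕ} (w b : Fin d → ℝ) {M : ℝ} (hM : 0 < M)
    {φ : (Fin d → ℝ) → ℂ} (hφ : ContDiff ℝ ∞ φ) (hc : HasCompactSupport φ)
    (hs : tsupport φ ⊆ {ξ | ∀ i, 0 < ξ i ∧ ξ i < M}) :
    ∫ x : Fin d → ℝ, ((∏ i, Real.tanh (w i * x i + b i) : ℝ) : ℂ) * testFourier φ x =
      ∫ ξ, tanhProdFourier w b ξ * φ ξ := by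
  set P : (Fin d → ℝ) → ℂ :=
    fun ξ => ∏ i, (1 - Complex.exp (-(Complex.I * (ξ i * M⁻¹ : ℝ)))) with hP
  have hPne : ∀ ξ ∈ tsupport φ, P ξ ≠ 0 := by
    intro ξ hξ
    refine Finset.prod_ne_zero_iff.2 fun i _ => one_sub_exp_ne_zero ?_ ?_
    · exact mul_pos (hs hξ i).1 (inv_pos.2 hM)
    · rw [← div_eq_mul_inv, div_lt_one hM]; exact (hs hξ i).2
  have hPs : ContDiff ℝ ∞ P := by
    refine contDiff_prod fun i _ => contDiff_const.sub (ContDiff.cexp ?_)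
    refine (contDiff_const.mul (Complex.ofRealCLM.contDiff.comp ?_)).neg
    exact (contDiff_apply ℝ ℝ i).mul contDiff_const
  have hψ := contDiff_div_of_tsupport hφ hPs hPne
  have hψc : HasCompactSupport fun ξ => φ ξ / P ξ := by
    simpa only [div_eq_mul_inv, Pi.mul_def] using hc.mul_right (f' := fun ξ => (P ξ)⁻¹)
  have hzero : ∀ ξ, φ ξ / P ξ * P ξ = φ ξ := by
    intro ξ
    by_cases h : ξ ∈ tsupport φ
    · exact div_mul_cancel₀ _ (hPne ξ h)
    · simp [image_eq_zero_of_notMem_tsupport h]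
  have h1 := integral_tanhProd_mul_testFourier w b hψ hψc M⁻¹
  rw [show (fun ξ => φ ξ / P ξ * ∏ i, (1 - Complex.exp (-(Complex.I * (ξ i * M⁻¹ : ℝ))))) = φ from
    funext hzero] at h1
  have hV : Integrable (fun x : Fin d → ℝ => ∏ i, (tanhDiff (w i) (b i) M⁻¹ (x i) : ℂ)) :=
    Integrable.fintype_prod (f := fun i x => (tanhDiff (w i) (b i) M⁻¹ x : ℂ)) fun i =>
      (integrable_tanhDiff (w i) (b i) M⁻¹).ofReal
  rw [h1, integral_mul_testFourier hV hψ.continuous hψc]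
  congr 1
  ext ξ
  by_cases h : ξ ∈ tsupport φ
  · rw [integral_prod_mul_exp (fun i x => (tanhDiff (w i) (b i) M⁻¹ x : ℂ)),
      Finset.prod_congr rfl fun i _ => integral_tanhDiff_mul_exp (w i) (b i) M⁻¹ (ξ i)
        (hs h i).1.ne', Finset.prod_mul_distrib, tanhProdFourier]
    conv_rhs => rw [← hzero ξ]
    simp only [hP]
    ring
  · simp [image_eq_zero_of_notMem_tsupport h]

/-- The Fourier transform of the network at a frequency with positive coordinates. -/
theorem hasFourierValue_eval {d r : ℕ} (Θ : TNNParams d r) (k : Fin d → ℝ) (hk : ∀ i, 0 < k i) :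
    HasFourierValue Θ.eval k (∑ j, (Θ.a j : ℂ) * tanhProdFourier (Θ.w j) (Θ.b j) k) := by
  obtain ⟨M, hM, hkM⟩ : ∃ M : ℝ, 0 < M ∧ ∀ i, k i < M :=
    ⟨1 + ∑ i, k i, by have := Finset.sum_nonneg fun i (_ : i ∈ Finset.univ) => (hk i).le; linarith,
      fun i => by
        have := Finset.single_le_sum (fun i _ => (hk i).le) (Finset.mem_univ i)
        linarith⟩
  set U : Set (Fin d → ℝ) := {ξ | ∀ i, 0 < ξ i ∧ ξ i < M} with hU
  have hUo : IsOpen U := by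
    simp only [hU, ofPred_forall]
    refine isOpen_iInter_of_finite fun i => ?_
    exact (isOpen_lt continuous_const (continuous_apply i)).inter
      (isOpen_lt (continuous_apply i) continuous_const)
  have hgj : ∀ j, ContinuousOn (fun ξ => tanhProdFourier (Θ.w j) (Θ.b j) ξ) U := by
    intro j
    refine continuousOn_const.mul (continuousOn_finsetProd _ fun i _ => ?_)
    exact (continuousOn_tanhFourier (Θ.w j i) (Θ.b j i)).comp (continuous_apply i).continuousOn
      fun ξ hξ => (hξ i).1
  refine ⟨U, hUo, fun i => ⟨hk i, hkM i⟩,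
    fun ξ => ∑ j, (Θ.a j : ℂ) * tanhProdFourier (Θ.w j) (Θ.b j) ξ,
    continuousOn_finsetSum _ fun j _ => continuousOn_const.mul (hgj j), rfl, ?_⟩
  intro φ hφ hc hs
  have hi : ∀ j, Integrable (fun x => (Θ.a j : ℂ) *
      (((∏ i, Real.tanh (Θ.w j i * x i + Θ.b j i) : ℝ) : ℂ) * testFourier φ x)) := fun j =>
    (integrable_tanhProd_mul _ _ (integrable_testFourier hφ hc)).const_mul _
  have hi' : ∀ j, Integrable (fun ξ => (Θ.a j : ℂ) *
      (tanhProdFourier (Θ.w j) (Θ.b j) ξ * φ ξ)) := by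
    intro j
    refine Integrable.const_mul ?_ _
    have hon : IntegrableOn (fun ξ => tanhProdFourier (Θ.w j) (Θ.b j) ξ * φ ξ) (tsupport φ) :=
      (((hgj j).mono hs).mul hφ.continuous.continuousOn).integrableOn_compact hc
    refine (integrableOn_iff_integrable_of_support_subset ?_).1 hon
    intro ξ hξ
    refine subset_tsupport _ ?_
    simp only [Function.mem_support, ne_eq, mul_eq_zero, not_or] at hξ ⊢
    exact hξ.2
  have e : (fun x => (Θ.eval x : ℂ) * testFourier φ x) = fun x => ∑ j, (Θ.a j : ℂ) *
      (((∏ i, Real.tanh (Θ.w j i * x i + Θ.b j i) : ℝ) : ℂ) * testFourier φ x) := by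
    ext x
    simp only [TNNParams.eval, Complex.ofReal_sum, Complex.ofReal_mul, Finset.sum_mul, mul_assoc]
  have e' : (fun ξ => (∑ j, (Θ.a j : ℂ) * tanhProdFourier (Θ.w j) (Θ.b j) ξ) * φ ξ) =
      fun ξ => ∑ j, (Θ.a j : ℂ) * (tanhProdFourier (Θ.w j) (Θ.b j) ξ * φ ξ) := by
    ext ξ
    simp only [Finset.sum_mul, mul_assoc]
  rw [e, e']
  refine ⟨integrable_finsetSum _ fun j _ => hi j, ?_⟩
  rw [integral_finsetSum _ fun j _ => hi j, integral_finsetSum _ fun j _ => hi' j]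
  refine Finset.sum_congr rfl fun j _ => ?_
  rw [integral_const_mul, integral_const_mul, integral_tanhProd_mul_testFourier_eq _ _ hM hφ hc hs]

theorem spectralError_eq {d r : ℕ} (f : (Fin d → ℝ) → ℝ) (k : Fin d → ℝ) (hk : ∀ i, 0 < k i)
    (Θ : TNNParams d r) :
    spectralError f k Θ =
      (∑ j, (Θ.a j : ℂ) * tanhProdFourier (Θ.w j) (Θ.b j) k) - fourierValue f k := by
  rw [spectralError, (hasFourierValue_eval Θ k hk).fourierValue_eq]

theorem sin_le_sin_of_mem_Icc {a x : ℝ} (ha : 0 ≤ a) (h1 : a ≤ x) (h2 : x ≤ Real.pi - a) :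
    Real.sin a ≤ Real.sin x := by
  rcases le_total x (Real.pi / 2) with h | h
  · exact Real.sin_le_sin_of_le_of_le_pi_div_two (by linarith [Real.pi_pos]) h h1
  · rw [← Real.sin_pi_sub x]
    exact Real.sin_le_sin_of_le_of_le_pi_div_two (by linarith [Real.pi_pos]) (by linarith)
      (by linarith)

/-- A unit complex number and its rotation by `α` cannot both be nearly imaginary. -/
theorem re_rotation_gt {y : ℂ} (hy : ‖y‖ = 1) {α s : ℝ} (hs : 0 < s) (hα : s ≤ |Real.sin α|)
    (h1 : |y.re| ≤ s / 4) : s / 4 < |(y * Complex.exp (Complex.I * α)).re| := by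
  by_contra! h2
  have e : (y * Complex.exp (Complex.I * α)).re = y.re * Real.cos α - y.im * Real.sin α := by
    rw [mul_comm Complex.I, Complex.mul_re, Complex.exp_ofReal_mul_I_re,
      Complex.exp_ofReal_mul_I_im]
  have hn : y.re ^ 2 + y.im ^ 2 = 1 := by
    have := Complex.sq_norm y
    rw [hy, Complex.normSq_apply] at this
    linarith
  have h3 : |y.im| * |Real.sin α| ≤ s / 2 := by
    rw [← abs_mul, show y.im * Real.sin α = y.re * Real.cos α -
      (y * Complex.exp (Complex.I * α)).re by rw [e]; ring]
    have h4 : |y.re * Real.cos α| ≤ s / 4 := by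
      rw [abs_mul]
      exact (mul_le_of_le_one_right (abs_nonneg _) (Real.abs_cos_le_one α)).trans h1
    linarith [abs_sub (y.re * Real.cos α) (y * Complex.exp (Complex.I * α)).re]
  have h5 : |y.im| ≤ 1 / 2 := by
    by_contra! h
    nlinarith [abs_nonneg y.im]
  have h6 : |y.re| ≤ 1 / 4 := by linarith [Real.abs_sin_le_one α]
  nlinarith [sq_abs y.re, sq_abs y.im, abs_nonneg y.re, abs_nonneg y.im]

/-- The set of `t ∈ (0, δ]` where `exp (i β / t) z` is nearly imaginary. -/
def oscillationSet (β : ℝ) (z : ℂ) (ε δ : ℝ) : Set ℝ :=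
  {t | t ∈ Ioc 0 δ ∧ |(Complex.exp (Complex.I * (β / t : ℝ)) * z).re| ≤ ε}

theorem measurableSet_oscillationSet (β : ℝ) (z : ℂ) (ε δ : ℝ) :
    MeasurableSet (oscillationSet β z ε δ) := by
  have : Measurable fun t : ℝ => (Complex.exp (Complex.I * (β / t : ℝ)) * z).re := by fun_prop
  exact measurableSet_Ioc.inter (measurableSet_le this.abs (measurable_const (a := ε)))

theorem quarter_volume_le_image {c δ : ℝ} (hc : 0 ≤ c) (hcδ : c * δ ≤ 1) {A : Set ℝ}
    (hA : MeasurableSet A) (hAδ : A ⊆ Ioc 0 δ) :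
    MeasurableSet ((fun t : ℝ => t / (1 + c * t)) '' A) ∧
    ENNReal.ofReal (1 / 4) * volume A ≤ volume ((fun t : ℝ => t / (1 + c * t)) '' A) := by
  have hpos : ∀ t ∈ A, 0 < 1 + c * t := fun t ht => by
    have := mul_nonneg hc (hAδ ht).1.le
    linarith
  have hd : ∀ t ∈ A, HasDerivWithinAt (fun t : ℝ => t / (1 + c * t)) (1 / (1 + c * t) ^ 2) A t := by
    intro t ht
    have h1 : HasDerivAt (fun t : ℝ => 1 + c * t) c t := by
      simpa using ((hasDerivAt_id t).const_mul c).const_add 1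
    have h2 := (hasDerivAt_id t).div h1 (hpos t ht).ne'
    refine HasDerivAt.hasDerivWithinAt (h2.congr_deriv ?_)
    simp only [id]
    ring
  have hinj : InjOn (fun t : ℝ => t / (1 + c * t)) A := by
    intro t ht t' ht' h
    simp only at h
    rw [div_eq_div_iff (hpos t ht).ne' (hpos t' ht').ne'] at h
    linarith
  refine ⟨hA.image_of_continuousOn_injOn (fun t ht => (hd t ht).continuousWithinAt) hinj, ?_⟩
  have h := lintegral_image_eq_lintegral_abs_deriv_mul hA hd hinj 1
  simp only [Pi.one_apply, mul_one, lintegral_one, Measure.restrict_apply_univ] at h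
  rw [h, ← setLIntegral_const]
  refine setLIntegral_mono' hA fun t ht => ENNReal.ofReal_le_ofReal ?_
  have h1 := hpos t ht
  have h2 : 1 + c * t ≤ 2 := by
    have := mul_le_mul_of_nonneg_left (hAδ ht).2 hc
    linarith
  rw [abs_of_pos (by positivity)]
  apply one_div_le_one_div_of_le (by positivity)
  nlinarith

/-- The set where `exp (i β / t) z` is nearly imaginary has small density at `0`: it has many
pairwise disjoint images under maps that distort lengths by a bounded factor. -/
theorem volume_oscillationSet_le {β : ℝ} (hβ : β ≠ 0) {M : ℕ} (hM : 2 ≤ M) :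
    ∃ ε > 0, ∃ δ₁ > 0, ∀ δ, 0 < δ → δ ≤ δ₁ → ∀ z : ℂ, ‖z‖ = 1 →
      volume (oscillationSet β z ε δ) ≤ ENNReal.ofReal (4 / M * δ) := by
  have hMR : (2 : ℝ) ≤ M := by exact_mod_cast hM
  have hM0 : (0 : ℝ) < M := by linarith
  have hπ := Real.pi_pos
  set a : ℝ := Real.pi / M with ha
  have ha0 : 0 < a := by positivity
  have haM : (M : ℝ) * a = Real.pi := by rw [ha]; field_simp
  have hs0 : 0 < Real.sin a := Real.sin_pos_of_pos_of_lt_pi ha0 (by nlinarith)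
  have hβ0 : 0 < |β| := abs_pos.2 hβ
  set c : ℝ := a / |β| with hc
  have hc0 : 0 < c := by positivity
  refine ⟨Real.sin a / 4, by positivity, (M * c)⁻¹, by positivity, ?_⟩
  intro δ hδ hδ₁ z hz
  set A := oscillationSet β z (Real.sin a / 4) δ with hA
  have hAm : MeasurableSet A := measurableSet_oscillationSet _ _ _ _
  have hAδ : A ⊆ Ioc 0 δ := fun t ht => ht.1
  have hT : ∀ m ∈ Finset.range M,
      MeasurableSet ((fun t : ℝ => t / (1 + (m * c) * t)) '' A) ∧
      ENNReal.ofReal (1 / 4) * volume A ≤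
        volume ((fun t : ℝ => t / (1 + (m * c) * t)) '' A) := by
    intro m hm
    refine quarter_volume_le_image (by positivity) ?_ hAm hAδ
    have hm' : (m : ℝ) ≤ M := by exact_mod_cast (Finset.mem_range.1 hm).le
    calc (m * c) * δ ≤ (M * c) * (M * c)⁻¹ := by gcongr
      _ = 1 := mul_inv_cancel₀ (by positivity)
  have hdis : ∀ m n : ℕ, m < n → n < M → ∀ t ∈ A, ∀ t' ∈ A,
      t / (1 + (m * c) * t) ≠ t' / (1 + (n * c) * t') := by
    intro m n hmn hn t ht t' ht' he
    have ht0 := ht.1.1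
    have ht0' := ht'.1.1
    have h1 : t⁻¹ = t'⁻¹ + (n - m) * c := by
      have p1 : 0 < 1 + (m * c) * t := by positivity
      have p2 : 0 < 1 + (n * c) * t' := by positivity
      rw [div_eq_div_iff p1.ne' p2.ne'] at he
      field_simp
      linarith
    have hmn' : (m : ℝ) + 1 ≤ n := by exact_mod_cast hmn
    have hn' : (n : ℝ) + 1 ≤ M := by exact_mod_cast hn
    have hm0 : (0 : ℝ) ≤ m := by positivity
    have h2 : Real.sin a ≤ |Real.sin ((n - m) * c * β)| := by
      have h3 : Real.sin a ≤ Real.sin ((n - m) * a) :=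
        sin_le_sin_of_mem_Icc ha0.le (by nlinarith) (by nlinarith)
      have h4 : c * |β| = a := by rw [hc]; field_simp
      rcases abs_choice β with h | h
      · rw [mul_assoc, ← h, h4]
        exact h3.trans (le_abs_self _)
      · have : (n - m) * c * β = -((n - m) * a) := by rw [← h4, h]; ring
        rw [this, Real.sin_neg, abs_neg]
        exact h3.trans (le_abs_self _)
    have hy : ‖Complex.exp (Complex.I * (β / t' : ℝ)) * z‖ = 1 := by
      rw [norm_mul, hz, mul_one, mul_comm Complex.I, Complex.norm_exp_ofReal_mul_I]
    refine absurd (re_rotation_gt hy hs0 h2 ht'.2) (not_lt.2 ?_)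
    have e : Complex.exp (Complex.I * (β / t' : ℝ)) * z *
        Complex.exp (Complex.I * ((n - m) * c * β : ℝ)) =
        Complex.exp (Complex.I * (β / t : ℝ)) * z := by
      rw [mul_right_comm, ← Complex.exp_add, ← mul_add, ← Complex.ofReal_add]
      congr 4
      rw [div_eq_mul_inv β t, h1]
      ring
    rw [e]
    exact ht.2
  have hpd : (↑(Finset.range M) : Set ℕ).PairwiseDisjoint
      (fun m : ℕ => (fun t : ℝ => t / (1 + (m * c) * t)) '' A) := by
    intro m hm n hn hmn
    refine Set.disjoint_left.2 ?_
    rintro _ ⟨t, ht, rfl⟩ ⟨t', ht', he⟩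
    rcases lt_or_gt_of_ne hmn with h | h
    · exact hdis m n h (Finset.mem_range.1 hn) t ht t' ht' he.symm
    · exact hdis n m h (Finset.mem_range.1 hm) t' ht' t ht he
  have hsub : (⋃ m ∈ Finset.range M, (fun t : ℝ => t / (1 + (m * c) * t)) '' A) ⊆ Ioc 0 δ := by
    refine iUnion₂_subset fun m _ => ?_
    rintro _ ⟨t, ht, rfl⟩
    have ht0 := (hAδ ht).1
    have p : 1 ≤ 1 + (m * c) * t := by
      have : 0 ≤ m * c * t := by positivity
      linarith
    exact ⟨div_pos ht0 (by linarith), (div_le_self ht0.le p).trans (hAδ ht).2⟩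
  have key : (M : ENNReal) * (ENNReal.ofReal (1 / 4) * volume A) ≤ ENNReal.ofReal δ := by
    calc (M : ENNReal) * (ENNReal.ofReal (1 / 4) * volume A)
        = ∑ m ∈ Finset.range M, ENNReal.ofReal (1 / 4) * volume A := by simp
      _ ≤ ∑ m ∈ Finset.range M, volume ((fun t : ℝ => t / (1 + (m * c) * t)) '' A) :=
          Finset.sum_le_sum fun m hm => (hT m hm).2
      _ = volume (⋃ m ∈ Finset.range M, (fun t : ℝ => t / (1 + (m * c) * t)) '' A) :=
          (measure_biUnion_finset hpd fun m hm => (hT m hm).1).symm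
      _ ≤ volume (Ioc 0 δ) := measure_mono hsub
      _ = ENNReal.ofReal δ := by simp
  calc volume A = ENNReal.ofReal (4 / M) * ((M : ENNReal) * (ENNReal.ofReal (1 / 4) * volume A)) := by
        rw [← ENNReal.ofReal_natCast M, ← mul_assoc, ← mul_assoc,
          ← ENNReal.ofReal_mul (by positivity), ← ENNReal.ofReal_mul (by positivity)]
        rw [show (4 / M * M * (1 / 4) : ℝ) = 1 by field_simp]
        simp
    _ ≤ ENNReal.ofReal (4 / M) * ENNReal.ofReal δ := by gcongr
    _ = _ := (ENNReal.ofReal_mul (by positivity)).symm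

/-- The points of the cube `(0, δ]^d` where `exp (i ∑ β i / t i) Z` is nearly imaginary. -/
def piOscillationSet {d : ℕ} (β : Fin d → ℝ) (Z : ℂ) (ε δ : ℝ) : Set (Fin d → ℝ) :=
  {t | (∀ i, t i ∈ Ioc 0 δ) ∧
    |(Complex.exp (Complex.I * ((∑ i, β i / t i : ℝ) : ℂ)) * Z).re| ≤ ε}

theorem measurableSet_piOscillationSet {d : ℕ} (β : Fin d → ℝ) (Z : ℂ) (ε δ : ℝ) :
    MeasurableSet (piOscillationSet β Z ε δ) := by
  have h1 : MeasurableSet {t : Fin d → ℝ | ∀ i, t i ∈ Ioc 0 δ} := by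
    have : MeasurableSet (univ.pi fun _ : Fin d => Ioc (0 : ℝ) δ) :=
      MeasurableSet.univ_pi fun _ => measurableSet_Ioc
    convert this using 1
    ext t
    simp
  have h2 : Measurable fun t : Fin d → ℝ =>
      (Complex.exp (Complex.I * ((∑ i, β i / t i : ℝ) : ℂ)) * Z).re := by fun_prop
  exact h1.inter (measurableSet_le h2.abs (measurable_const (a := ε)))

theorem volume_piOscillationSet_le {d : ℕ} (hd : 0 < d) {β : Fin d → ℝ} (hβ : ∀ i, β i ≠ 0)
    {Z : ℂ} (hZ : Z ≠ 0) {η : ℝ} (hη : 0 < η) :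
    ∃ ε > 0, ∃ δ₁ > 0, ∀ δ, 0 < δ → δ ≤ δ₁ →
      volume (piOscillationSet β Z ε δ) ≤ ENNReal.ofReal (η * δ ^ d) := by
  obtain ⟨n, rfl⟩ : ∃ n, d = n + 1 := ⟨d - 1, by omega⟩
  obtain ⟨M, hMη⟩ := exists_nat_ge (4 / η)
  obtain ⟨ε, hε, δ₁, hδ₁, H⟩ := volume_oscillationSet_le (hβ 0) (M := M + 2) (by omega)
  have hZ0 : 0 < ‖Z‖ := norm_pos_iff.2 hZ
  refine ⟨ε * ‖Z‖, by positivity, δ₁, hδ₁, fun δ hδ hδδ₁ => ?_⟩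
  set S := piOscillationSet β Z (ε * ‖Z‖) δ with hS
  have hSm : MeasurableSet S := measurableSet_piOscillationSet _ _ _ _
  have hmp := (volume_preserving_piFinSuccAbove (fun _ : Fin (n + 1) => ℝ) 0).symm
  set e := (MeasurableEquiv.piFinSuccAbove (fun _ : Fin (n + 1) => ℝ) 0).symm with he
  have hex : ∀ x y, e (x, y) = Fin.cons x y := fun x y => by
    simp [he, MeasurableEquiv.piFinSuccAbove]
    rfl
  rw [← hmp.measure_preimage hSm.nullMeasurableSet, Measure.volume_eq_prod,
    Measure.prod_apply_symm (e.measurable hSm)]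
  have hMle : 4 / ((M + 2 : ℕ) : ℝ) ≤ η := by
    rw [div_le_iff₀ hη] at hMη
    rw [div_le_iff₀ (by positivity)]
    push_cast
    nlinarith
  have hslice : ∀ y : Fin n → ℝ, volume ((fun x => (x, y)) ⁻¹' (e ⁻¹' S)) ≤
      (univ.pi fun _ : Fin n => Ioc (0 : ℝ) δ).indicator (fun _ => ENNReal.ofReal (η * δ)) y := by
    intro y
    by_cases hy : y ∈ univ.pi fun _ : Fin n => Ioc (0 : ℝ) δ
    · rw [indicator_of_mem hy]
      set z : ℂ := Complex.exp (Complex.I * ((∑ i : Fin n, β i.succ / y i : ℝ) : ℂ)) *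
        ((‖Z‖⁻¹ : ℝ) * Z) with hz
      have hz1 : ‖z‖ = 1 := by
        rw [hz, norm_mul, mul_comm Complex.I, Complex.norm_exp_ofReal_mul_I, norm_mul,
          Complex.norm_real, Real.norm_of_nonneg (by positivity), one_mul, inv_mul_cancel₀ hZ0.ne']
      refine le_trans (measure_mono ?_) ((H δ hδ hδδ₁ z hz1).trans
        (ENNReal.ofReal_le_ofReal (by gcongr)))
      intro x hx
      simp only [mem_preimage, hex] at hx
      refine ⟨by simpa using hx.1 0, ?_⟩
      have h := hx.2
      rw [Fin.sum_univ_succ] at h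
      simp only [Fin.cons_zero, Fin.cons_succ] at h
      have e1 : Complex.exp (Complex.I * (β 0 / x : ℝ)) * z = (‖Z‖⁻¹ : ℝ) *
          (Complex.exp (Complex.I * ((β 0 / x + ∑ i : Fin n, β i.succ / y i : ℝ) : ℂ)) * Z) := by
        rw [hz, Complex.ofReal_add, mul_add, Complex.exp_add]
        ring
      rw [e1, Complex.re_ofReal_mul, abs_mul, abs_of_pos (by positivity),
        inv_mul_le_iff₀ hZ0, mul_comm ‖Z‖]
      exact h
    · rw [indicator_of_notMem hy]
      refine le_of_eq (measure_mono_null (t := ∅) ?_ measure_empty)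
      intro x hx
      simp only [mem_preimage, hex] at hx
      refine hy fun i _ => ?_
      simpa using hx.1 i.succ
  refine (lintegral_mono hslice).trans ?_
  rw [lintegral_indicator_const (MeasurableSet.univ_pi fun _ => measurableSet_Ioc),
    volume_pi_pi]
  simp only [Real.volume_Ioc, sub_zero, Finset.prod_const, Finset.card_univ, Fintype.card_fin]
  rw [← ENNReal.ofReal_pow hδ.le, ← ENNReal.ofReal_mul (by positivity)]
  exact ENNReal.ofReal_le_ofReal (by rw [pow_succ]; nlinarith)

/-- `w ^ 2` times the logarithmic derivative of `w ↦ tanhFourier w b ξ`. -/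
noncomputable def weightFactor (w b ξ : ℝ) : ℂ :=
  -w - Complex.I * (b * ξ : ℝ) +
    (w / |w| * (Real.pi * ξ / 2) *
      (Real.cosh (Real.pi * ξ / (2 * |w|)) / Real.sinh (Real.pi * ξ / (2 * |w|))) : ℝ)

theorem sinh_pi_mul_div_pos {w ξ : ℝ} (hw : w ≠ 0) (hξ : 0 < ξ) :
    0 < Real.sinh (Real.pi * ξ / (2 * |w|)) := by
  have := abs_pos.2 hw
  have := Real.pi_pos
  exact Real.sinh_pos_iff.2 (by positivity)

theorem hasDerivAt_tanhFourier_bias (w b ξ : ℝ) :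
    HasDerivAt (fun s => tanhFourier w s ξ)
      (tanhFourier w b ξ * ((w⁻¹ : ℝ) * (Complex.I * ξ))) b := by
  have h1 : HasDerivAt (fun s : ℝ => Complex.I * ((s * ξ / w : ℝ) : ℂ))
      (Complex.I * ((ξ / w : ℝ) : ℂ)) b := by
    have := (((hasDerivAt_id b).mul_const ξ).div_const w).ofReal_comp.const_mul Complex.I
    simpa using this
  have h2 := (h1.cexp.const_mul (-(Complex.I * Real.pi) * (w : ℂ)⁻¹)).div_const
    ((Real.sinh (Real.pi * ξ / (2 * |w|)) : ℝ) : ℂ)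
  refine h2.congr_deriv ?_
  rw [tanhFourier]
  push_cast
  ring

theorem hasDerivAt_tanhFourier_weight {w ξ : ℝ} (b : ℝ) (hw : w ≠ 0) (hξ : 0 < ξ) :
    HasDerivAt (fun s => tanhFourier s b ξ)
      (tanhFourier w b ξ * (((w ^ 2)⁻¹ : ℝ) * weightFactor w b ξ)) w := by
  have hS := sinh_pi_mul_div_pos hw hξ
  have hwa := abs_pos.2 hw
  have habs : HasDerivAt (fun s : ℝ => |s|) (w / |w|) w := by
    refine (hasDerivAt_abs hw).congr_deriv ?_
    rcases lt_or_gt_of_ne hw with h | h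
    · rw [abs_of_neg h, sign_neg h]; simp [hw]
    · rw [abs_of_pos h, sign_pos h]; simp [hw]
  have h1 : HasDerivAt (fun s : ℝ => Real.pi * ξ / (2 * |s|))
      (-(Real.pi * ξ / 2 * (w / |w|) / w ^ 2)) w := by
    have := (hasDerivAt_const w (Real.pi * ξ)).div (habs.const_mul 2) (by positivity)
    refine this.congr_deriv ?_
    rw [mul_pow, sq_abs]
    field_simp
    ring
  have h2 := h1.sinh.ofReal_comp
  have h3 : HasDerivAt (fun s : ℝ => Complex.I * ((b * ξ / s : ℝ) : ℂ))
      (Complex.I * ((-(b * ξ / w ^ 2) : ℝ) : ℂ)) w := by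
    have := ((hasDerivAt_const w (b * ξ)).div (hasDerivAt_id w) hw).ofReal_comp.const_mul
      Complex.I
    refine this.congr_deriv ?_
    simp [neg_div]
  have h4 : HasDerivAt (fun s : ℝ => (s : ℂ)⁻¹) (-((w : ℂ) ^ 2)⁻¹) w := by
    have := (hasDerivAt_inv hw).ofReal_comp
    simpa using this
  have hS' : ((Real.sinh (Real.pi * ξ / (2 * |w|)) : ℝ) : ℂ) ≠ 0 := by exact_mod_cast hS.ne'
  have h5 := ((h4.const_mul (-(Complex.I * Real.pi))).mul h3.cexp).div h2 hS'
  refine h5.congr_deriv ?_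
  have hw' : (w : ℂ) ≠ 0 := by exact_mod_cast hw
  rw [tanhFourier, weightFactor]
  simp only [Pi.mul_apply, Complex.ofReal_neg, Complex.ofReal_mul,
    Complex.ofReal_div _ (Real.sinh _), Complex.ofReal_inv, Complex.ofReal_pow]
  generalize ((Real.sinh (Real.pi * ξ / (2 * |w|)) : ℝ) : ℂ) = S at hS' ⊢
  generalize ((Real.cosh (Real.pi * ξ / (2 * |w|)) : ℝ) : ℂ) = K
  generalize Complex.exp (Complex.I * ((b * ξ / w : ℝ) : ℂ)) = e
  simp only [Complex.ofReal_div _ (w ^ 2), Complex.ofReal_mul, Complex.ofReal_pow]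
  generalize ((w / |w| : ℝ) : ℂ) = σ
  push_cast
  field_simp
  ring

theorem hasDerivAt_prod_update {ι : Type*} [Fintype ι] [DecidableEq ι] {F : ι → ℝ → ℂ} {w : ι → ℝ}
    {m : ι} {c : ℂ} (h : HasDerivAt (F m) (F m (w m) * c) (w m)) :
    HasDerivAt (fun s => ∏ i, F i (Function.update w m s i)) ((∏ i, F i (w i)) * c) (w m) := by
  have e : ∀ s, ∏ i, F i (Function.update w m s i) =
      F m s * ∏ i ∈ Finset.univ.erase m, F i (w i) := by
    intro s
    rw [← Finset.mul_prod_erase Finset.univ _ (Finset.mem_univ m), Function.update_self]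
    congr 1
    exact Finset.prod_congr rfl fun i hi => by
      rw [Function.update_of_ne (Finset.ne_of_mem_erase hi)]
  have e' := e (w m)
  rw [Function.update_eq_self] at e'
  rw [e', funext e]
  refine (h.mul_const _).congr_deriv ?_
  ring

theorem hasDerivAt_sum_single {ι : Type*} [Fintype ι] [DecidableEq ι] {F : ι → ℝ → ℂ} {j : ι}
    {c : ℂ} {x : ℝ} (h : HasDerivAt (F j) c x) (h' : ∀ i, i ≠ j → ∀ s, F i s = F i x) :
    HasDerivAt (fun s => ∑ i, F i s) c x := by
  have := HasDerivAt.fun_sum (u := Finset.univ) (A := F) (A' := fun i => if i = j then c else 0)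
    (x := x) fun i _ => by
      by_cases hi : i = j
      · subst hi; simpa using h
      · rw [if_neg hi, funext (h' i hi)]
        exact hasDerivAt_const _ _
  simpa using this

/-- The real factor of the logarithmic derivative of a neuron that does not depend on the
frequency. -/
noncomputable def paramScale {d : ℕ} (a : ℝ) (w : Fin d → ℝ) : ParamIndex d → ℝ
  | .a => a⁻¹
  | .w m => (w m ^ 2)⁻¹
  | .b m => (w m)⁻¹

/-- The factor of the logarithmic derivative of a neuron that depends on the frequency. -/
noncomputable def paramFactor {d : ℕ} (w b ξ : Fin d → ℝ) : ParamIndex d → ℂ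
  | .a => 1
  | .w m => weightFactor (w m) (b m) (ξ m)
  | .b m => Complex.I * ξ m

theorem hasDerivAt_spectralError {d r : ℕ} (f : (Fin d → ℝ) → ℝ) {k : Fin d → ℝ}
    (hk : ∀ i, 0 < k i) (Θ : TNNParams d r) (j : Fin r) (ha : Θ.a j ≠ 0) (hw : ∀ i, Θ.w j i ≠ 0)
    (l : ParamIndex d) :
    HasDerivAt (fun s => spectralError f k (Θ.set j l s))
      (Θ.a j * tanhProdFourier (Θ.w j) (Θ.b j) k *
        (paramScale (Θ.a j) (Θ.w j) l * paramFactor (Θ.w j) (Θ.b j) k l)) (Θ.get j l) := by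
  simp only [spectralError_eq f k hk]
  refine HasDerivAt.sub_const _ ?_
  cases l with
  | a =>
    refine hasDerivAt_sum_single (j := j) (F := fun i s => ((TNNParams.set Θ j .a s).a i : ℂ) *
      tanhProdFourier ((TNNParams.set Θ j .a s).w i) ((TNNParams.set Θ j .a s).b i) k) ?_ ?_
    · simp only [TNNParams.set, TNNParams.get, Function.update_self, paramScale, paramFactor]
      have := (hasDerivAt_id (Θ.a j)).ofReal_comp.mul_const (tanhProdFourier (Θ.w j) (Θ.b j) k)
      refine this.congr_deriv ?_
      have : (Θ.a j : ℂ) ≠ 0 := by exact_mod_cast ha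
      push_cast
      field_simp
    · intro i hi s
      simp [TNNParams.set, Function.update_of_ne hi]
  | w m =>
    refine hasDerivAt_sum_single (j := j) (F := fun i s => ((TNNParams.set Θ j (.w m) s).a i : ℂ) *
      tanhProdFourier ((TNNParams.set Θ j (.w m) s).w i) ((TNNParams.set Θ j (.w m) s).b i) k)
      ?_ ?_
    · simp only [TNNParams.set, TNNParams.get, Function.update_self, paramScale, paramFactor,
        tanhProdFourier]
      have := hasDerivAt_prod_update (F := fun i s => tanhFourier s (Θ.b j i) (k i)) (w := Θ.w j)
        (m := m) (hasDerivAt_tanhFourier_weight (Θ.b j m) (hw m) (hk m))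
      refine ((this.const_mul _).const_mul _).congr_deriv ?_
      ring
    · intro i hi s
      simp [TNNParams.set, Function.update_of_ne hi]
  | b m =>
    refine hasDerivAt_sum_single (j := j) (F := fun i s => ((TNNParams.set Θ j (.b m) s).a i : ℂ) *
      tanhProdFourier ((TNNParams.set Θ j (.b m) s).w i) ((TNNParams.set Θ j (.b m) s).b i) k)
      ?_ ?_
    · simp only [TNNParams.set, TNNParams.get, Function.update_self, paramScale, paramFactor,
        tanhProdFourier]
      have := hasDerivAt_prod_update (F := fun i s => tanhFourier (Θ.w j i) s (k i)) (w := Θ.b j)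
        (m := m) (hasDerivAt_tanhFourier_bias (Θ.w j m) (Θ.b j m) (k m))
      refine ((this.const_mul _).const_mul _).congr_deriv ?_
      ring
    · intro i hi s
      simp [TNNParams.set, Function.update_of_ne hi]

theorem TNNParams.set_get {d r : ℕ} (Θ : TNNParams d r) (j : Fin r) (l : ParamIndex d) :
    Θ.set j l (Θ.get j l) = Θ := by
  cases l <;> simp [TNNParams.set, TNNParams.get]

theorem hasDerivAt_spectralLoss {d r : ℕ} (f : (Fin d → ℝ) → ℝ) {k : Fin d → ℝ}
    (hk : ∀ i, 0 < k i) (Θ : TNNParams d r) (j : Fin r) (ha : Θ.a j ≠ 0) (hw : ∀ i, Θ.w j i ≠ 0)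
    (l : ParamIndex d) :
    HasDerivAt (fun s => spectralLoss f k (Θ.set j l s))
      (2 * ((starRingEnd ℂ) (spectralError f k Θ) * (Θ.a j * tanhProdFourier (Θ.w j) (Θ.b j) k *
        (paramScale (Θ.a j) (Θ.w j) l * paramFactor (Θ.w j) (Θ.b j) k l))).re) (Θ.get j l) := by
  have h := (hasDerivAt_spectralError f hk Θ j ha hw l).norm_sq
  rw [TNNParams.set_get, Complex.inner, mul_comm (_ * _ : ℂ)] at h
  exact h

/-- The real factor of `tanhProdFourier` that decays as the weights tend to `0`. -/
noncomputable def sinhProd {d : ℕ} (w ξ : Fin d → ℝ) : ℝ :=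
  ∏ i, Real.sinh (Real.pi * ξ i / (2 * |w i|))

theorem sinhProd_pos {d : ℕ} {w ξ : Fin d → ℝ} (hw : ∀ i, w i ≠ 0) (hξ : ∀ i, 0 < ξ i) :
    0 < sinhProd w ξ :=
  Finset.prod_pos fun i _ => sinh_pi_mul_div_pos (hw i) (hξ i)

theorem tanhProdFourier_eq {d : ℕ} (w b ξ : Fin d → ℝ) :
    tanhProdFourier w b ξ =
      ((((√(2 * Real.pi) ^ d)⁻¹ * ∏ i, (w i)⁻¹) * (sinhProd w ξ)⁻¹ : ℝ) : ℂ) *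
        (Complex.exp (Complex.I * ((∑ i, b i * ξ i / w i : ℝ) : ℂ)) *
          (-(Complex.I * Real.pi)) ^ d) := by
  have e : Complex.exp (Complex.I * ((∑ i, b i * ξ i / w i : ℝ) : ℂ)) =
      ∏ i, Complex.exp (Complex.I * (b i * ξ i / w i : ℝ)) := by
    rw [← Complex.exp_sum, ← Finset.mul_sum]
    push_cast
    rfl
  simp only [tanhProdFourier, tanhFourier, Finset.prod_div_distrib, Finset.prod_mul_distrib,
    Finset.prod_const, Finset.card_univ, Fintype.card_fin, sinhProd, Complex.ofReal_mul,
    Complex.ofReal_prod, Complex.ofReal_inv, e]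
  ring

/-- If one of the partial derivatives of the loss at the lower frequency does not dominate, then
the oscillating factor of that derivative is small. -/
theorem gradientDominates_or_oscillation {d r : ℕ} (f : (Fin d → ℝ) → ℝ) {k₁ k₂ : Fin d → ℝ}
    (hk₁ : ∀ i, 0 < k₁ i) (hk₂ : ∀ i, 0 < k₂ i) (Θ : TNNParams d r) (j : Fin r)
    (ha : Θ.a j ≠ 0) (hw : ∀ i, Θ.w j i ≠ 0) (h : ¬ GradientDominates f k₁ k₂ Θ j) :
    ∃ l, |(Complex.exp (Complex.I * ((∑ i, Θ.b j i * k₁ i / Θ.w j i : ℝ) : ℂ)) *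
        ((-(Complex.I * Real.pi)) ^ d * (starRingEnd ℂ) (spectralError f k₁ Θ) *
          paramFactor (Θ.w j) (Θ.b j) k₁ l)).re| ≤
      Real.pi ^ d * ‖spectralError f k₂ Θ‖ * ‖paramFactor (Θ.w j) (Θ.b j) k₂ l‖ *
        (sinhProd (Θ.w j) k₁ / sinhProd (Θ.w j) k₂) := by
  rw [GradientDominates] at h
  push Not at h
  obtain ⟨l, h⟩ := h
  have d1 := hasDerivAt_spectralLoss f hk₁ Θ j ha hw l
  have d2 := hasDerivAt_spectralLoss f hk₂ Θ j ha hw l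
  have h := h d1.differentiableAt d2.differentiableAt
  refine ⟨l, ?_⟩
  rw [partialLoss, partialLoss, d1.deriv, d2.deriv] at h
  have p1 := sinhProd_pos hw hk₁
  have p2 := sinhProd_pos hw hk₂
  set c : ℝ := Θ.a j * paramScale (Θ.a j) (Θ.w j) l *
    ((√(2 * Real.pi) ^ d)⁻¹ * ∏ i, (Θ.w j i)⁻¹) with hc
  have hc0 : c ≠ 0 := by
    have h1 : paramScale (Θ.a j) (Θ.w j) l ≠ 0 := by
      cases l with
      | a => exact inv_ne_zero ha
      | w m => exact inv_ne_zero (pow_ne_zero _ (hw m))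
      | b m => exact inv_ne_zero (hw m)
    have h2 : ∏ i, (Θ.w j i)⁻¹ ≠ 0 := Finset.prod_ne_zero_iff.2 fun i _ => inv_ne_zero (hw i)
    have h3 : (√(2 * Real.pi) ^ d)⁻¹ ≠ 0 := by
      have := Real.pi_pos
      positivity
    exact mul_ne_zero (mul_ne_zero ha h1) (mul_ne_zero h3 h2)
  have e : ∀ k : Fin d → ℝ, (starRingEnd ℂ) (spectralError f k Θ) *
      (Θ.a j * tanhProdFourier (Θ.w j) (Θ.b j) k *
        (paramScale (Θ.a j) (Θ.w j) l * paramFactor (Θ.w j) (Θ.b j) k l)) =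
      ((c * (sinhProd (Θ.w j) k)⁻¹ : ℝ) : ℂ) *
        (Complex.exp (Complex.I * ((∑ i, Θ.b j i * k i / Θ.w j i : ℝ) : ℂ)) *
        ((-(Complex.I * Real.pi)) ^ d * (starRingEnd ℂ) (spectralError f k Θ) *
          paramFactor (Θ.w j) (Θ.b j) k l)) := by
    intro k
    rw [tanhProdFourier_eq, hc]
    simp only [Complex.ofReal_mul]
    ring
  rw [e, e, Complex.re_ofReal_mul, Complex.re_ofReal_mul] at h
  simp only [abs_mul, abs_inv, abs_two, abs_of_pos p1, abs_of_pos p2] at h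
  have hc' := abs_pos.2 hc0
  set R₁ := |(Complex.exp (Complex.I * ((∑ i, Θ.b j i * k₁ i / Θ.w j i : ℝ) : ℂ)) *
        ((-(Complex.I * Real.pi)) ^ d * (starRingEnd ℂ) (spectralError f k₁ Θ) *
          paramFactor (Θ.w j) (Θ.b j) k₁ l)).re|
  have hR₂ : |(Complex.exp (Complex.I * ((∑ i, Θ.b j i * k₂ i / Θ.w j i : ℝ) : ℂ)) *
        ((-(Complex.I * Real.pi)) ^ d * (starRingEnd ℂ) (spectralError f k₂ Θ) *
          paramFactor (Θ.w j) (Θ.b j) k₂ l)).re| ≤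
      Real.pi ^ d * ‖spectralError f k₂ Θ‖ * ‖paramFactor (Θ.w j) (Θ.b j) k₂ l‖ := by
    refine (Complex.abs_re_le_norm _).trans (le_of_eq ?_)
    rw [norm_mul, mul_comm Complex.I, Complex.norm_exp_ofReal_mul_I, norm_mul, norm_mul, norm_pow,
      norm_neg, norm_mul, Complex.norm_I, Complex.norm_real, Real.norm_of_nonneg Real.pi_pos.le,
      RCLike.norm_conj]
    ring
  set R₂ := |(Complex.exp (Complex.I * ((∑ i, Θ.b j i * k₂ i / Θ.w j i : ℝ) : ℂ)) *
        ((-(Complex.I * Real.pi)) ^ d * (starRingEnd ℂ) (spectralError f k₂ Θ) *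
          paramFactor (Θ.w j) (Θ.b j) k₂ l)).re|
  have h1 : (sinhProd (Θ.w j) k₁)⁻¹ * R₁ ≤ (sinhProd (Θ.w j) k₂)⁻¹ * R₂ := by
    have : (2 * |c|) * ((sinhProd (Θ.w j) k₁)⁻¹ * R₁) ≤
        (2 * |c|) * ((sinhProd (Θ.w j) k₂)⁻¹ * R₂) := by linarith
    exact le_of_mul_le_mul_left this (by positivity)
  calc R₁ ≤ sinhProd (Θ.w j) k₁ * ((sinhProd (Θ.w j) k₂)⁻¹ * R₂) := (inv_mul_le_iff₀ p1).1 h1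
    _ = R₂ * (sinhProd (Θ.w j) k₁ / sinhProd (Θ.w j) k₂) := by ring
    _ ≤ _ := by gcongr

theorem sinh_eq_exp_mul (x : ℝ) :
    Real.sinh x = Real.exp x * (1 - Real.exp (-(2 * x))) / 2 := by
  rw [Real.sinh_eq, show -(2 * x) = -x + -x by ring, Real.exp_add, Real.exp_neg]
  have := Real.exp_pos x
  field_simp

theorem cosh_eq_exp_mul (x : ℝ) :
    Real.cosh x = Real.exp x * (1 + Real.exp (-(2 * x))) / 2 := by
  rw [Real.cosh_eq, show -(2 * x) = -x + -x by ring, Real.exp_add, Real.exp_neg]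
  have := Real.exp_pos x
  field_simp

theorem tendsto_exp_neg_mul_atTop {c : ℝ} (hc : 0 < c) :
    Tendsto (fun u : ℝ => Real.exp (-(c * u))) atTop (𝓝 0) :=
  Real.tendsto_exp_neg_atTop_nhds_zero.comp (tendsto_id.const_mul_atTop hc)

theorem tendsto_sinh_div_sinh_atTop {c₁ c₂ : ℝ} (h₁ : 0 < c₁) (h₂ : c₁ < c₂) :
    Tendsto (fun u : ℝ => Real.sinh (c₁ * u) / Real.sinh (c₂ * u)) atTop (𝓝 0) := by
  have e : ∀ u : ℝ, Real.sinh (c₁ * u) / Real.sinh (c₂ * u) = Real.exp (-((c₂ - c₁) * u)) *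
      ((1 - Real.exp (-(2 * c₁ * u))) / (1 - Real.exp (-(2 * c₂ * u)))) := by
    intro u
    rw [sinh_eq_exp_mul, sinh_eq_exp_mul, show -((c₂ - c₁) * u) = c₁ * u - c₂ * u by ring,
      Real.exp_sub, mul_assoc 2, mul_assoc 2, div_div_div_cancel_right₀ two_ne_zero,
      mul_div_mul_comm]
  have h := (tendsto_exp_neg_mul_atTop (sub_pos.2 h₂)).mul
    (((tendsto_exp_neg_mul_atTop (c := 2 * c₁) (by linarith)).const_sub 1).div
      ((tendsto_exp_neg_mul_atTop (c := 2 * c₂) (by linarith)).const_sub 1) (by norm_num))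
  rw [zero_mul] at h
  exact h.congr fun u => (e u).symm

theorem tendsto_cosh_div_sinh_atTop {c : ℝ} (hc : 0 < c) :
    Tendsto (fun u : ℝ => Real.cosh (c * u) / Real.sinh (c * u)) atTop (𝓝 1) := by
  have e : ∀ u : ℝ, Real.cosh (c * u) / Real.sinh (c * u) =
      (1 + Real.exp (-(2 * c * u))) / (1 - Real.exp (-(2 * c * u))) := by
    intro u
    rw [sinh_eq_exp_mul, cosh_eq_exp_mul, mul_assoc 2, div_div_div_cancel_right₀ two_ne_zero,
      mul_div_mul_left _ _ (Real.exp_pos _).ne']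
  have h := ((tendsto_exp_neg_mul_atTop (c := 2 * c) (by linarith)).const_add 1).div
      ((tendsto_exp_neg_mul_atTop (c := 2 * c) (by linarith)).const_sub 1) (by norm_num)
  norm_num at h
  exact h.congr fun u => (e u).symm

theorem tendsto_div_sinh_atTop {c : ℝ} (hc : 0 < c) :
    Tendsto (fun u : ℝ => u / Real.sinh (c * u)) atTop (𝓝 0) := by
  have e : ∀ u : ℝ, u / Real.sinh (c * u) =
      2 * (u * Real.exp (-(c * u))) / (1 - Real.exp (-(2 * c * u))) := by
    intro u
    rw [sinh_eq_exp_mul, mul_assoc 2 c, Real.exp_neg (c * u)]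
    have := Real.exp_pos (c * u)
    rw [div_div_eq_mul_div, div_mul_eq_div_div]
    ring
  have h0 : Tendsto (fun u : ℝ => u * Real.exp (-(c * u))) atTop (𝓝 0) := by
    have := tendsto_rpow_mul_exp_neg_mul_atTop_nhds_zero 1 c hc
    simpa using this
  have h := (h0.const_mul 2).div
      ((tendsto_exp_neg_mul_atTop (c := 2 * c) (by linarith)).const_sub 1) (by norm_num)
  norm_num at h
  exact h.congr fun u => (e u).symm

theorem eventually_abs_sign_mul {s : ℝ} (hs : |s| = 1) (c : ℝ) :
    ∀ᶠ t : ℝ in 𝓝[>] 0, c / (2 * |s * t|) = c / 2 * t⁻¹ := by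
  filter_upwards [self_mem_nhdsWithin] with t ht
  rw [abs_mul, hs, one_mul, abs_of_pos ht]
  ring

theorem tendsto_sinh_ratio {s k₁ k₂ : ℝ} (hs : |s| = 1) (h₁ : 0 < k₁) (h₂ : k₁ < k₂) :
    Tendsto (fun t : ℝ => Real.sinh (Real.pi * k₁ / (2 * |s * t|)) /
      Real.sinh (Real.pi * k₂ / (2 * |s * t|))) (𝓝[>] 0) (𝓝 0) := by
  have hπ := Real.pi_pos
  refine ((tendsto_sinh_div_sinh_atTop (c₁ := Real.pi * k₁ / 2) (c₂ := Real.pi * k₂ / 2)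
    (by positivity) (by nlinarith)).comp tendsto_inv_nhdsGT_zero).congr' ?_
  filter_upwards [eventually_abs_sign_mul hs (Real.pi * k₁),
    eventually_abs_sign_mul hs (Real.pi * k₂)] with t e1 e2
  rw [e1, e2, Function.comp_apply]

theorem tendsto_tanhFourier_zero {s ξ : ℝ} (b : ℝ) (hs : |s| = 1) (hξ : 0 < ξ) :
    Tendsto (fun t : ℝ => tanhFourier (s * t) b ξ) (𝓝[>] 0) (𝓝 0) := by
  have hπ := Real.pi_pos
  rw [tendsto_zero_iff_norm_tendsto_zero]
  have h := ((tendsto_div_sinh_atTop (c := Real.pi * ξ / 2) (by positivity)).comp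
    tendsto_inv_nhdsGT_zero).const_mul Real.pi
  rw [mul_zero] at h
  refine h.congr' ?_
  filter_upwards [eventually_abs_sign_mul hs (Real.pi * ξ), self_mem_nhdsWithin] with t e1 ht
  have ht0 : 0 < t := ht
  have hS : 0 < Real.sinh (Real.pi * ξ / 2 * t⁻¹) := Real.sinh_pos_iff.2 (by positivity)
  rw [tanhFourier, e1, Function.comp_apply, norm_div, norm_mul, norm_mul, mul_comm Complex.I (_ : ℂ),
    norm_neg, norm_mul, Complex.norm_I, mul_comm Complex.I, Complex.norm_exp_ofReal_mul_I,
    Complex.norm_real, Complex.norm_real, norm_inv, Complex.norm_real, Real.norm_of_nonneg hS.le,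
    Real.norm_of_nonneg hπ.le, Real.norm_eq_abs, abs_mul, hs, abs_of_pos ht0]
  ring

theorem tendsto_weightFactor {s ξ : ℝ} (b : ℝ) (hs : |s| = 1) (hξ : 0 < ξ) :
    Tendsto (fun t : ℝ => weightFactor (s * t) b ξ) (𝓝[>] 0)
      (𝓝 (-(Complex.I * (b * ξ : ℝ)) + (s * (Real.pi * ξ / 2) : ℝ))) := by
  have hπ := Real.pi_pos
  have h0 : Tendsto (fun t : ℝ => ((s * t : ℝ) : ℂ)) (𝓝[>] 0) (𝓝 0) := by
    have : Continuous fun t : ℝ => ((s * t : ℝ) : ℂ) := by fun_prop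
    simpa using (this.tendsto 0).mono_left nhdsWithin_le_nhds
  have h1 := ((tendsto_cosh_div_sinh_atTop (c := Real.pi * ξ / 2) (by positivity)).comp
    tendsto_inv_nhdsGT_zero).const_mul (s * (Real.pi * ξ / 2))
  have h2 := (Complex.continuous_ofReal.tendsto _).comp h1
  have h3 := (h0.neg.sub_const (Complex.I * (b * ξ : ℝ))).add h2
  rw [mul_one, neg_zero, zero_sub] at h3
  refine h3.congr' ?_
  filter_upwards [eventually_abs_sign_mul hs (Real.pi * ξ), self_mem_nhdsWithin] with t e1 ht
  have ht0 : 0 < t := ht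
  have e2 : s * t / |s * t| = s := by
    rw [abs_mul, hs, one_mul, abs_of_pos ht0, mul_div_cancel_right₀ _ ht0.ne']
  rw [weightFactor, e1, e2]
  rfl

/-- The limit of `paramFactor` as the weights tend to `0` with signs `s`. -/
noncomputable def paramFactorLimit {d : ℕ} (s b ξ : Fin d → ℝ) : ParamIndex d → ℂ
  | .a => 1
  | .w m => -(Complex.I * (b m * ξ m : ℝ)) + (s m * (Real.pi * ξ m / 2) : ℝ)
  | .b m => Complex.I * ξ m

theorem paramFactorLimit_ne_zero {d : ℕ} {s b ξ : Fin d → ℝ} (hs : ∀ i, |s i| = 1)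
    (hξ : ∀ i, 0 < ξ i) (l : ParamIndex d) : paramFactorLimit s b ξ l ≠ 0 := by
  cases l with
  | a => exact one_ne_zero
  | w m =>
    intro h
    have h1 := congrArg Complex.re h
    simp only [paramFactorLimit, Complex.add_re, Complex.neg_re, Complex.re_mul_ofReal,
      Complex.I_re, zero_mul, neg_zero, zero_add, Complex.ofReal_re, Complex.zero_re] at h1
    have h2 : s m ≠ 0 := fun h => by simpa [h] using hs m
    have h3 : Real.pi * ξ m / 2 ≠ 0 := by have := hξ m; have := Real.pi_pos; positivity
    exact mul_ne_zero h2 h3 h1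
  | b m =>
    have h1 : (ξ m : ℂ) ≠ 0 := by exact_mod_cast (hξ m).ne'
    exact mul_ne_zero Complex.I_ne_zero h1

section Limits

variable {X : Type*} {L : Filter X} {d : ℕ} {s b ξ : Fin d → ℝ} {t : X → Fin d → ℝ}

theorem tendsto_paramFactor (hs : ∀ i, |s i| = 1) (hξ : ∀ i, 0 < ξ i)
    (ht : ∀ i, Tendsto (fun x => t x i) L (𝓝[>] 0)) (l : ParamIndex d) :
    Tendsto (fun x => paramFactor (fun i => s i * t x i) b ξ l) L
      (𝓝 (paramFactorLimit s b ξ l)) := by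
  cases l with
  | a => exact tendsto_const_nhds
  | w m => exact (tendsto_weightFactor (b m) (hs m) (hξ m)).comp (ht m)
  | b m => exact tendsto_const_nhds

theorem tendsto_tanhProdFourier_zero (hd : 0 < d) (hs : ∀ i, |s i| = 1) (hξ : ∀ i, 0 < ξ i)
    (ht : ∀ i, Tendsto (fun x => t x i) L (𝓝[>] 0)) :
    Tendsto (fun x => tanhProdFourier (fun i => s i * t x i) b ξ) L (𝓝 0) := by
  have h := (tendsto_finsetProd Finset.univ fun i _ =>
    (tendsto_tanhFourier_zero (b i) (hs i) (hξ i)).comp (ht i)).const_mul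
      ((((√(2 * Real.pi) ^ d)⁻¹ : ℝ) : ℂ))
  rw [Finset.prod_const, Finset.card_univ, Fintype.card_fin, zero_pow hd.ne', mul_zero] at h
  exact h

theorem tendsto_sinhProd_ratio (hd : 0 < d) (hs : ∀ i, |s i| = 1) {k₁ k₂ : Fin d → ℝ}
    (hk₁ : ∀ i, 0 < k₁ i) (hk₂ : ∀ i, k₁ i < k₂ i)
    (ht : ∀ i, Tendsto (fun x => t x i) L (𝓝[>] 0)) :
    Tendsto (fun x => sinhProd (fun i => s i * t x i) k₁ / sinhProd (fun i => s i * t x i) k₂) L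
      (𝓝 0) := by
  have h := tendsto_finsetProd Finset.univ fun i _ =>
    (tendsto_sinh_ratio (hs i) (hk₁ i) (hk₂ i)).comp (ht i)
  rw [Finset.prod_const, Finset.card_univ, Fintype.card_fin, zero_pow hd.ne'] at h
  simp only [sinhProd, ← Finset.prod_div_distrib]
  exact h

end Limits

instance ParamIndex.finite (d : ℕ) : Finite (ParamIndex d) := by
  refine Finite.of_surjective
    (fun o : Option (Fin d ⊕ Fin d) => match o with
      | none => ParamIndex.a
      | some (.inl m) => ParamIndex.w m
      | some (.inr m) => ParamIndex.b m) ?_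
  rintro (_ | m | m)
  · exact ⟨none, rfl⟩
  · exact ⟨some (.inl m), rfl⟩
  · exact ⟨some (.inr m), rfl⟩

/-- The limit of the complex factor of a partial derivative of the loss. -/
noncomputable def limitFactor {d : ℕ} (D : ℂ) (s b ξ : Fin d → ℝ) (l : ParamIndex d) : ℂ :=
  (-(Complex.I * Real.pi)) ^ d * (starRingEnd ℂ) D * paramFactorLimit s b ξ l

theorem limitFactor_ne_zero {d : ℕ} {D : ℂ} (hD : D ≠ 0) {s b ξ : Fin d → ℝ}
    (hs : ∀ i, |s i| = 1) (hξ : ∀ i, 0 < ξ i) (l : ParamIndex d) :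
    limitFactor D s b ξ l ≠ 0 := by
  refine mul_ne_zero (mul_ne_zero (pow_ne_zero _ (neg_ne_zero.2 (mul_ne_zero Complex.I_ne_zero ?_)))
    ?_) (paramFactorLimit_ne_zero hs hξ l)
  · exact_mod_cast Real.pi_ne_zero
  · simpa using hD

/-- As the weights of a neuron tend to `0`, domination fails only where the limiting oscillating
factor of one of the derivatives is small. -/
theorem eventually_gradientDominates_or_oscillation {X : Type*} {L : Filter X} {d r : ℕ}
    (hd : 0 < d) (f : (Fin d → ℝ) → ℝ) {k₁ k₂ : Fin d → ℝ} (hk₁ : ∀ i, 0 < k₁ i)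
    (hk₂ : ∀ i, k₁ i < k₂ i) {Θ : X → TNNParams d r} {j : Fin r} (ha : ∀ x, (Θ x).a j ≠ 0)
    {s b : Fin d → ℝ} (hs : ∀ i, |s i| = 1) (hb : ∀ x, (Θ x).b j = b) {t : X → Fin d → ℝ}
    (hw : ∀ x, (Θ x).w j = fun i => s i * t x i) (ht : ∀ i, Tendsto (fun x => t x i) L (𝓝[>] 0))
    {D : ℂ} (hD : Tendsto (fun x => spectralError f k₁ (Θ x)) L (𝓝 D)) {c : ℝ}
    (hc : ∀ᶠ x in L, ‖spectralError f k₂ (Θ x)‖ < c) {ε : ParamIndex d → ℝ} (hε : ∀ l, 0 < ε l) :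
    ∀ᶠ x in L, ¬ GradientDominates f k₁ k₂ (Θ x) j → ∃ l,
      |(Complex.exp (Complex.I * ((∑ i, b i * k₁ i / s i / t x i : ℝ) : ℂ)) *
        limitFactor D s b k₁ l).re| ≤ ε l := by
  have hk₂' : ∀ i, 0 < k₂ i := fun i => (hk₁ i).trans (hk₂ i)
  have h1 : ∀ l, Tendsto (fun x => ‖limitFactor D s b k₁ l - (-(Complex.I * Real.pi)) ^ d *
      (starRingEnd ℂ) (spectralError f k₁ (Θ x)) * paramFactor (fun i => s i * t x i) b k₁ l‖) L
      (𝓝 0) := by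
    intro l
    have h := ((((Complex.continuous_conj.tendsto D).comp hD).const_mul
      ((-(Complex.I * Real.pi) : ℂ) ^ d)).mul
        (tendsto_paramFactor (b := b) hs hk₁ ht l)).const_sub (limitFactor D s b k₁ l)
    rw [← tendsto_zero_iff_norm_tendsto_zero]
    rw [limitFactor, sub_self] at h
    exact h
  have h2 : ∀ l, Tendsto (fun x => Real.pi ^ d * c *
      ‖paramFactor (fun i => s i * t x i) b k₂ l‖ *
        (sinhProd (fun i => s i * t x i) k₁ / sinhProd (fun i => s i * t x i) k₂)) L (𝓝 0) := by
    intro l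
    have h := (((tendsto_paramFactor (b := b) hs hk₂' ht l).norm.const_mul
      (Real.pi ^ d * c))).mul (tendsto_sinhProd_ratio hd hs hk₁ hk₂ ht)
    rwa [mul_zero] at h
  have h3 : ∀ᶠ x in L, ∀ l, ‖limitFactor D s b k₁ l - (-(Complex.I * Real.pi)) ^ d *
      (starRingEnd ℂ) (spectralError f k₁ (Θ x)) * paramFactor (fun i => s i * t x i) b k₁ l‖ +
      Real.pi ^ d * c * ‖paramFactor (fun i => s i * t x i) b k₂ l‖ *
        (sinhProd (fun i => s i * t x i) k₁ / sinhProd (fun i => s i * t x i) k₂) < ε l := by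
    refine eventually_all.2 fun l => ?_
    have h := (h1 l).add (h2 l)
    rw [add_zero] at h
    exact h.eventually (gt_mem_nhds (hε l))
  have h4 : ∀ᶠ x in L, ∀ i, 0 < t x i :=
    eventually_all.2 fun i => (ht i).eventually self_mem_nhdsWithin
  filter_upwards [h3, h4, hc] with x h3 h4 hc hn
  have hs0 : ∀ i, s i ≠ 0 := fun i h => by simpa [h] using hs i
  have hw0 : ∀ i, (Θ x).w j i ≠ 0 := fun i => by
    rw [hw]; exact mul_ne_zero (hs0 i) (h4 i).ne'
  obtain ⟨l, hl⟩ := gradientDominates_or_oscillation f hk₁ hk₂' (Θ x) j (ha x) hw0 hn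
  refine ⟨l, ?_⟩
  have p1 := sinhProd_pos hw0 hk₁
  have p2 := sinhProd_pos hw0 hk₂'
  rw [hw x] at p1 p2
  rw [hw x, hb x] at hl
  have e : ∑ i, b i * k₁ i / s i / t x i = ∑ i, b i * k₁ i / (s i * t x i) :=
    Finset.sum_congr rfl fun i _ => div_div _ _ _
  rw [e]
  set W := Complex.exp (Complex.I * ((∑ i, b i * k₁ i / (s i * t x i) : ℝ) : ℂ)) with hW
  have hWn : ‖W‖ = 1 := by rw [hW, mul_comm, Complex.norm_exp_ofReal_mul_I]
  set Z := (-(Complex.I * Real.pi)) ^ d * (starRingEnd ℂ) (spectralError f k₁ (Θ x)) *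
    paramFactor (fun i => s i * t x i) b k₁ l with hZ
  calc |(W * limitFactor D s b k₁ l).re|
      = |(W * (limitFactor D s b k₁ l - Z)).re + (W * Z).re| := by
        rw [← Complex.add_re]; congr 2; ring
    _ ≤ |(W * (limitFactor D s b k₁ l - Z)).re| + |(W * Z).re| := abs_add_le _ _
    _ ≤ ‖limitFactor D s b k₁ l - Z‖ + Real.pi ^ d * c *
        ‖paramFactor (fun i => s i * t x i) b k₂ l‖ *
        (sinhProd (fun i => s i * t x i) k₁ / sinhProd (fun i => s i * t x i) k₂) := by
        refine add_le_add ?_ (hl.trans ?_)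
        · refine (Complex.abs_re_le_norm _).trans ?_
          rw [norm_mul, hWn, one_mul]
        · gcongr
    _ ≤ ε l := (h3 l).le

/-- The filter generated by the sets `Q δ` with `δ > 0`. -/
def cubeFilter {X : Type*} (Q : ℝ → Set X) : Filter X := ⨅ δ ∈ Ioi (0 : ℝ), 𝓟 (Q δ)

theorem eventually_cubeFilter {X : Type*} {Q : ℝ → Set X} (hQ : Monotone Q) {P : X → Prop} :
    (∀ᶠ x in cubeFilter Q, P x) ↔ ∃ δ > 0, ∀ x ∈ Q δ, P x := by
  have h : (cubeFilter Q).HasBasis (fun δ : ℝ => δ ∈ Ioi (0 : ℝ)) Q := by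
    refine hasBasis_biInf_principal ?_ ⟨1, mem_Ioi.2 one_pos⟩
    intro a ha b hb
    exact ⟨min a b, mem_Ioi.2 (lt_min ha hb), hQ (min_le_left _ _), hQ (min_le_right _ _)⟩
  rw [h.eventually_iff]
  rfl

theorem cubeFilter_neBot {X : Type*} {Q : ℝ → Set X} (hQ : Monotone Q)
    (hne : ∀ δ > 0, (Q δ).Nonempty) : (cubeFilter Q).NeBot := by
  refine ⟨fun h => ?_⟩
  have : ∀ᶠ x in cubeFilter Q, False := by rw [h]; exact eventually_bot
  obtain ⟨δ, hδ, H⟩ := (eventually_cubeFilter hQ).1 this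
  obtain ⟨x, hx⟩ := hne δ hδ
  exact H x hx

theorem tendsto_cubeFilter {X : Type*} {Q : ℝ → Set X} (hQ : Monotone Q) {g : X → ℝ}
    (hg : ∀ δ, ∀ x ∈ Q δ, g x ∈ Ioc 0 δ) : Tendsto g (cubeFilter Q) (𝓝[>] 0) := by
  rw [(nhdsGT_basis (0 : ℝ)).tendsto_right_iff]
  intro u hu
  refine (eventually_cubeFilter hQ).2 ⟨u / 2, half_pos hu, fun x hx => ?_⟩
  have := hg _ x hx
  exact ⟨this.1, by linarith [this.2]⟩

/-- A criterion for a set to have density `1` along a family of cubes. -/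
theorem tendsto_density_one {X : Type*} [MeasureSpace X] {G : Set X} {Q : ℝ → Set X} {N : ℕ}
    (hQ : ∀ δ > 0, volume (Q δ) = ENNReal.ofReal (δ ^ N))
    (h : ∀ η > 0, ∀ᶠ δ in 𝓝[>] (0 : ℝ), volume (Q δ \ G) ≤ ENNReal.ofReal (η * δ ^ N)) :
    Tendsto (fun δ : ℝ => volume.real (G ∩ Q δ) / δ ^ N) (𝓝[>] 0) (𝓝 1) := by
  rw [Metric.tendsto_nhds]
  intro η hη
  filter_upwards [h (η / 2) (half_pos hη), self_mem_nhdsWithin] with δ hδ hδ0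
  have hδ0' : 0 < δ := hδ0
  have hN : 0 < δ ^ N := pow_pos hδ0' N
  have hfin : volume (Q δ) ≠ ⊤ := by rw [hQ δ hδ0']; exact ENNReal.ofReal_ne_top
  have hQr : volume.real (Q δ) = δ ^ N := by
    rw [Measure.real, hQ δ hδ0', ENNReal.toReal_ofReal hN.le]
  have h1 : volume.real (G ∩ Q δ) ≤ δ ^ N := by
    rw [← hQr]; exact measureReal_mono inter_subset_right hfin
  have h2 : δ ^ N ≤ volume.real (G ∩ Q δ) + volume.real (Q δ \ G) := by
    rw [← hQr]
    refine (measureReal_mono (s₂ := G ∩ Q δ ∪ Q δ \ G) ?_ ?_).trans (measureReal_union_le _ _)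
    · intro x hx
      by_cases hG : x ∈ G
      · exact Or.inl ⟨hG, hx⟩
      · exact Or.inr ⟨hx, hG⟩
    · exact measure_ne_top_of_subset (union_subset inter_subset_right sdiff_subset) hfin
  have h3 : volume.real (Q δ \ G) ≤ η / 2 * δ ^ N := by
    have := ENNReal.toReal_mono ENNReal.ofReal_ne_top hδ
    rwa [ENNReal.toReal_ofReal (by positivity)] at this
  rw [Real.dist_eq, abs_lt]
  constructor
  · rw [neg_lt_sub_iff_lt_add, ← sub_lt_iff_lt_add', lt_div_iff₀ hN]
    nlinarith
  · have := (div_le_one hN).2 h1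
    linarith

theorem volume_iUnion_piOscillationSet_le {d : ℕ} (hd : 0 < d) {ι : Type*} [Finite ι]
    {β : ι → Fin d → ℝ} (hβ : ∀ q i, β q i ≠ 0) {Z : ι → ℂ} (hZ : ∀ q, Z q ≠ 0) {η : ℝ}
    (hη : 0 < η) :
    ∃ ε : ι → ℝ, (∀ q, 0 < ε q) ∧ ∀ᶠ δ in 𝓝[>] (0 : ℝ),
      volume (⋃ q, piOscillationSet (β q) (Z q) (ε q) δ) ≤ ENNReal.ofReal (η * δ ^ d) := by
  have := Fintype.ofFinite ι
  have hη' : 0 < η / (Fintype.card ι + 1) := by positivity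
  choose ε hε δ₁ hδ₁ H using fun q => volume_piOscillationSet_le hd (hβ q) (hZ q) hη'
  refine ⟨ε, hε, ?_⟩
  have h : ∀ᶠ δ in 𝓝[>] (0 : ℝ), ∀ q, δ ∈ Ioc 0 (δ₁ q) :=
    eventually_all.2 fun q => Ioc_mem_nhdsGT (hδ₁ q)
  filter_upwards [h, self_mem_nhdsWithin] with δ h hδ
  have hδ0 : 0 < δ := hδ
  calc volume (⋃ q, piOscillationSet (β q) (Z q) (ε q) δ)
      ≤ ∑ q, volume (piOscillationSet (β q) (Z q) (ε q) δ) := measure_iUnion_fintype_le _ _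
    _ ≤ ∑ _q : ι, ENNReal.ofReal (η / (Fintype.card ι + 1) * δ ^ d) :=
        Finset.sum_le_sum fun q _ => H q δ (h q).1 (h q).2
    _ = ENNReal.ofReal (Fintype.card ι * (η / (Fintype.card ι + 1) * δ ^ d)) := by
        rw [Finset.sum_const, Finset.card_univ, nsmul_eq_mul,
          ENNReal.ofReal_mul (p := (Fintype.card ι : ℝ)) (by positivity), ENNReal.ofReal_natCast]
    _ ≤ ENNReal.ofReal (η * δ ^ d) := by
        refine ENNReal.ofReal_le_ofReal ?_
        rw [← mul_assoc]
        gcongr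
        rw [mul_div_assoc', div_le_iff₀ (by positivity)]
        nlinarith

/-- The sign `±1` that is encoded by a truth value. -/
def boolSign (s : Bool) : ℝ := if s then 1 else -1

theorem abs_boolSign (s : Bool) : |boolSign s| = 1 := by
  cases s <;> simp [boolSign]

theorem boolSign_ne_zero (s : Bool) : boolSign s ≠ 0 := by
  cases s <;> simp [boolSign]

theorem eq_boolSign_mul {v t : ℝ} (h : |v| = t) : v = boolSign (decide (0 ≤ v)) * t := by
  rw [← h]
  by_cases hv : 0 ≤ v
  · simp [boolSign, hv, abs_of_nonneg hv]
  · simp [boolSign, hv, abs_of_neg (not_le.1 hv)]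

/-- The cube `(0, δ]^d`. -/
def cube (d : ℕ) (δ : ℝ) : Set (Fin d → ℝ) := {t | ∀ i, t i ∈ Ioc 0 δ}

/-- The cube `(0, δ]^(r × d)`. -/
def cubes (r d : ℕ) (δ : ℝ) : Set (Fin r → Fin d → ℝ) := {t | ∀ j i, t j i ∈ Ioc 0 δ}

theorem cube_mono (d : ℕ) : Monotone (cube d) :=
  fun _ _ h _ ht i => ⟨(ht i).1, (ht i).2.trans h⟩

theorem cubes_mono (r d : ℕ) : Monotone (cubes r d) :=
  fun _ _ h _ ht j i => ⟨(ht j i).1, (ht j i).2.trans h⟩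

theorem cubes_eq_pi (r d : ℕ) (δ : ℝ) : cubes r d δ = univ.pi fun _ => cube d δ := by
  ext t; simp [cubes, cube]

theorem volume_cube (d : ℕ) {δ : ℝ} (hδ : 0 < δ) :
    volume (cube d δ) = ENNReal.ofReal (δ ^ d) := by
  have : cube d δ = univ.pi fun _ => Ioc 0 δ := by ext t; simp [cube]
  rw [this, volume_pi_pi]
  simp [ENNReal.ofReal_pow hδ.le]

theorem volume_cubes (r d : ℕ) {δ : ℝ} (hδ : 0 < δ) :
    volume (cubes r d δ) = ENNReal.ofReal (δ ^ (r * d)) := by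
  rw [cubes_eq_pi, volume_pi_pi]
  simp [volume_cube d hδ, ← ENNReal.ofReal_pow (pow_nonneg hδ.le d), ← pow_mul, mul_comm]

/-- A set of small density in one block of variables has small density in all variables. -/
theorem volume_cubes_block_le {r d : ℕ} (j : Fin r) {B : Set (Fin d → ℝ)} {δ η : ℝ} (hδ : 0 < δ)
    (hη : 0 ≤ η) (hB : volume B ≤ ENNReal.ofReal (η * δ ^ d)) :
    volume {t | t ∈ cubes r d δ ∧ t j ∈ B} ≤ ENNReal.ofReal (η * δ ^ (r * d)) := by
  have hsub : {t | t ∈ cubes r d δ ∧ t j ∈ B} ⊆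
      univ.pi (Function.update (fun _ => cube d δ) j B) := by
    rintro t ⟨ht, hj⟩ i -
    by_cases hi : i = j
    · subst hi; simpa using hj
    · rw [Function.update_of_ne hi]; exact ht i
  refine (measure_mono hsub).trans ?_
  rw [volume_pi_pi, ← Finset.mul_prod_erase Finset.univ _ (Finset.mem_univ j),
    Function.update_self, Finset.prod_congr rfl fun i hi => by
      rw [Function.update_of_ne (Finset.ne_of_mem_erase hi), volume_cube d hδ]]
  rw [Finset.prod_const, Finset.card_erase_of_mem (Finset.mem_univ j), Finset.card_univ,
    Fintype.card_fin]
  have hr : 0 < r := j.pos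
  calc volume B * ENNReal.ofReal (δ ^ d) ^ (r - 1)
      ≤ ENNReal.ofReal (η * δ ^ d) * ENNReal.ofReal (δ ^ d) ^ (r - 1) := by gcongr
    _ = ENNReal.ofReal (η * δ ^ (r * d)) := by
        rw [← ENNReal.ofReal_pow (by positivity), ← ENNReal.ofReal_mul (by positivity)]
        congr 1
        rw [mul_assoc, ← pow_succ', Nat.sub_add_cancel hr, ← pow_mul, mul_comm d r]

/-- The case where the inner weights of one neuron are small. -/
theorem tendsto_density_gradientDominates_neuron {d r : ℕ} (hd : 0 < d) (Θ : TNNParams d r)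
    (j : Fin r) (ha : Θ.a j ≠ 0) (hb : ∀ i, Θ.b j i ≠ 0) {k₁ k₂ : Fin d → ℝ}
    (hk₁ : ∀ i, 0 < k₁ i) (hk₂ : ∀ i, k₁ i < k₂ i) (f : (Fin d → ℝ) → ℝ) {c₁ c₂ : ℝ}
    (hc₁ : 0 < c₁) {δ₀ : ℝ} (hδ₀ : 0 < δ₀)
    (h : ∀ v : Fin d → ℝ, (∀ i, |v i| ∈ Ioc 0 δ₀) →
      ‖spectralError f k₁ (Θ.withNeuronWeights j v)‖ > c₁ ∧
      ‖spectralError f k₂ (Θ.withNeuronWeights j v)‖ < c₂) :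
    Tendsto (fun δ : ℝ => volume.real
        ({t : Fin d → ℝ | ∀ v : Fin d → ℝ, (∀ i, |v i| = t i) →
            GradientDominates f k₁ k₂ (Θ.withNeuronWeights j v) j} ∩ cube d δ) / δ ^ d)
      (𝓝[>] 0) (𝓝 1) := by
  set L := cubeFilter (cube d) with hL
  let sg : (Fin d → Bool) → Fin d → ℝ := fun s i => boolSign (s i)
  let Θ' : (Fin d → Bool) → (Fin d → ℝ) → TNNParams d r := fun s t =>
    Θ.withNeuronWeights j (fun i => sg s i * t i)
  have hsg : ∀ s i, |sg s i| = 1 := fun s i => abs_boolSign _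
  have ht : ∀ i, Tendsto (fun t : Fin d → ℝ => t i) L (𝓝[>] 0) := fun i =>
    tendsto_cubeFilter (cube_mono d) fun δ x hx => hx i
  have hwj : ∀ s t, (Θ' s t).w j = fun i => sg s i * t i := fun s t => by
    simp [Θ', TNNParams.withNeuronWeights, TNNParams.withWeights]
  have hev : ∀ s, ∀ᶠ t in L, c₁ < ‖spectralError f k₁ (Θ' s t)‖ ∧
      ‖spectralError f k₂ (Θ' s t)‖ < c₂ := fun s =>
    (eventually_cubeFilter (cube_mono d)).2 ⟨δ₀, hδ₀, fun t ht' => h _ fun i => by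
      rw [abs_mul, hsg, one_mul, abs_of_pos (ht' i).1]; exact ht' i⟩
  set D : ℂ := (∑ i, if i = j then 0 else (Θ.a i : ℂ) * tanhProdFourier (Θ.w i) (Θ.b i) k₁) -
    fourierValue f k₁ with hDdef
  have hD : ∀ s, Tendsto (fun t => spectralError f k₁ (Θ' s t)) L (𝓝 D) := by
    intro s
    simp only [spectralError_eq f k₁ hk₁]
    refine Tendsto.sub_const (tendsto_finsetSum _ fun i _ => ?_) _
    by_cases hi : i = j
    · subst hi
      simp only [hwj, if_true]
      have := (tendsto_tanhProdFourier_zero (b := Θ.b i) hd (hsg s) hk₁ ht).const_mul (Θ.a i : ℂ)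
      rwa [mul_zero] at this
    · rw [if_neg hi]
      have : ∀ t, (Θ' s t).w i = Θ.w i := fun t => by
        simp [Θ', TNNParams.withNeuronWeights, TNNParams.withWeights, Function.update_of_ne hi]
      simp only [this]
      exact tendsto_const_nhds
  have hD0 : D ≠ 0 := by
    have : L.NeBot := cubeFilter_neBot (cube_mono d) fun δ hδ => ⟨fun _ => δ, fun _ => ⟨hδ, le_rfl⟩⟩
    have h1 := ge_of_tendsto (hD fun _ => true).norm
      ((hev fun _ => true).mono fun t ht => ht.1.le)
    exact norm_pos_iff.1 (hc₁.trans_le h1)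
  refine tendsto_density_one (fun δ hδ => volume_cube d hδ) fun η hη => ?_
  obtain ⟨ε, hε, hvol⟩ := volume_iUnion_piOscillationSet_le hd
    (ι := (Fin d → Bool) × ParamIndex d)
    (β := fun q i => Θ.b j i * k₁ i / sg q.1 i)
    (fun q i => div_ne_zero (mul_ne_zero (hb i) (hk₁ i).ne') (boolSign_ne_zero _))
    (Z := fun q => limitFactor D (sg q.1) (Θ.b j) k₁ q.2)
    (fun q => limitFactor_ne_zero hD0 (hsg q.1) hk₁ q.2) hη
  have key : ∀ᶠ t in L, ∀ s, ¬ GradientDominates f k₁ k₂ (Θ' s t) j → ∃ l,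
      |(Complex.exp (Complex.I * ((∑ i, Θ.b j i * k₁ i / sg s i / t i : ℝ) : ℂ)) *
        limitFactor D (sg s) (Θ.b j) k₁ l).re| ≤ ε (s, l) :=
    eventually_all.2 fun s => eventually_gradientDominates_or_oscillation (Θ := Θ' s) (s := sg s)
      (b := Θ.b j) (t := fun t => t) (ε := fun l => ε (s, l)) hd f hk₁ hk₂ (fun _ => ha) (hsg s)
      (fun _ => rfl) (hwj s) ht (hD s) ((hev s).mono fun t ht => ht.2) fun l => hε (s, l)
  obtain ⟨δ₁, hδ₁, H⟩ := (eventually_cubeFilter (cube_mono d)).1 key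
  filter_upwards [hvol, Ioc_mem_nhdsGT hδ₁] with δ hvol hδ
  refine (measure_mono ?_).trans hvol
  rintro t ⟨htc, hG⟩
  simp only [mem_ofPred_eq, not_forall] at hG
  obtain ⟨v, hv, hG⟩ := hG
  have hvs : v = fun i => sg (fun i => decide (0 ≤ v i)) i * t i :=
    funext fun i => eq_boolSign_mul (hv i)
  rw [hvs] at hG
  obtain ⟨l, hl⟩ := H t (cube_mono d hδ.2 htc) _ hG
  exact mem_iUnion.2 ⟨(_, l), htc, hl⟩

/-- The case where the inner weights of all neurons are small. -/
theorem tendsto_density_gradientDominates_all {d r : ℕ} (hd : 0 < d) (Θ : TNNParams d r)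
    (ha : ∀ j, Θ.a j ≠ 0) (hb : ∀ j i, Θ.b j i ≠ 0) {k₁ k₂ : Fin d → ℝ}
    (hk₁ : ∀ i, 0 < k₁ i) (hk₂ : ∀ i, k₁ i < k₂ i) (f : (Fin d → ℝ) → ℝ) {c₁ c₂ : ℝ}
    (hc₁ : 0 < c₁) {δ₀ : ℝ} (hδ₀ : 0 < δ₀)
    (h : ∀ w : Fin r → Fin d → ℝ, (∀ j i, |w j i| ∈ Ioc 0 δ₀) →
      ‖spectralError f k₁ (Θ.withWeights w)‖ > c₁ ∧
      ‖spectralError f k₂ (Θ.withWeights w)‖ < c₂) :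
    Tendsto (fun δ : ℝ => volume.real
        ({t : Fin r → Fin d → ℝ | ∀ w : Fin r → Fin d → ℝ, (∀ j i, |w j i| = t j i) →
            ∀ j, GradientDominates f k₁ k₂ (Θ.withWeights w) j} ∩ cubes r d δ) / δ ^ (r * d))
      (𝓝[>] 0) (𝓝 1) := by
  set L := cubeFilter (cubes r d) with hL
  let sg : (Fin d → Bool) → Fin d → ℝ := fun s i => boolSign (s i)
  let Θ' : (Fin r → Fin d → Bool) → (Fin r → Fin d → ℝ) → TNNParams d r := fun s t =>
    Θ.withWeights (fun j i => sg (s j) i * t j i)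
  have hsg : ∀ s i, |sg s i| = 1 := fun s i => abs_boolSign _
  have ht : ∀ j i, Tendsto (fun t : Fin r → Fin d → ℝ => t j i) L (𝓝[>] 0) := fun j i =>
    tendsto_cubeFilter (cubes_mono r d) fun δ x hx => hx j i
  have hev : ∀ s, ∀ᶠ t in L, c₁ < ‖spectralError f k₁ (Θ' s t)‖ ∧
      ‖spectralError f k₂ (Θ' s t)‖ < c₂ := fun s =>
    (eventually_cubeFilter (cubes_mono r d)).2 ⟨δ₀, hδ₀, fun t ht' => h _ fun j i => by
      rw [abs_mul, hsg, one_mul, abs_of_pos (ht' j i).1]; exact ht' j i⟩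
  set D : ℂ := (∑ _j : Fin r, 0) - fourierValue f k₁ with hDdef
  have hD : ∀ s, Tendsto (fun t => spectralError f k₁ (Θ' s t)) L (𝓝 D) := by
    intro s
    simp only [spectralError_eq f k₁ hk₁]
    refine Tendsto.sub_const (tendsto_finsetSum _ fun j _ => ?_) _
    have := (tendsto_tanhProdFourier_zero (b := Θ.b j) hd (hsg (s j)) hk₁ (ht j)).const_mul
      (Θ.a j : ℂ)
    rwa [mul_zero] at this
  have hD0 : D ≠ 0 := by
    have : L.NeBot := cubeFilter_neBot (cubes_mono r d) fun δ hδ =>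
      ⟨fun _ _ => δ, fun _ _ => ⟨hδ, le_rfl⟩⟩
    have h1 := ge_of_tendsto (hD fun _ _ => true).norm
      ((hev fun _ _ => true).mono fun t ht => ht.1.le)
    exact norm_pos_iff.1 (hc₁.trans_le h1)
  refine tendsto_density_one (fun δ hδ => volume_cubes r d hδ) fun η hη => ?_
  have hη' : 0 < η / (r + 1) := by positivity
  choose ε hε hvol using fun j => volume_iUnion_piOscillationSet_le hd
    (ι := (Fin d → Bool) × ParamIndex d)
    (β := fun q i => Θ.b j i * k₁ i / sg q.1 i)
    (fun q i => div_ne_zero (mul_ne_zero (hb j i) (hk₁ i).ne') (boolSign_ne_zero _))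
    (Z := fun q => limitFactor D (sg q.1) (Θ.b j) k₁ q.2)
    (fun q => limitFactor_ne_zero hD0 (hsg q.1) hk₁ q.2) hη'
  have key : ∀ᶠ t in L, ∀ s j, ¬ GradientDominates f k₁ k₂ (Θ' s t) j → ∃ l,
      |(Complex.exp (Complex.I * ((∑ i, Θ.b j i * k₁ i / sg (s j) i / t j i : ℝ) : ℂ)) *
        limitFactor D (sg (s j)) (Θ.b j) k₁ l).re| ≤ ε j (s j, l) :=
    eventually_all.2 fun s => eventually_all.2 fun j =>
      eventually_gradientDominates_or_oscillation (Θ := Θ' s) (s := sg (s j)) (b := Θ.b j)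
        (t := fun t => t j) (ε := fun l => ε j (s j, l)) hd f hk₁ hk₂ (fun _ => ha j) (hsg (s j))
        (fun _ => rfl) (fun _ => rfl) (ht j) (hD s) ((hev s).mono fun t ht => ht.2)
        fun l => hε j (s j, l)
  obtain ⟨δ₁, hδ₁, H⟩ := (eventually_cubeFilter (cubes_mono r d)).1 key
  filter_upwards [eventually_all.2 hvol, Ioc_mem_nhdsGT hδ₁] with δ hvol hδ
  let B : Fin r → Set (Fin d → ℝ) := fun j => ⋃ q : (Fin d → Bool) × ParamIndex d,
    piOscillationSet (fun i => Θ.b j i * k₁ i / sg q.1 i) (limitFactor D (sg q.1) (Θ.b j) k₁ q.2)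
      (ε j q) δ
  have hsub : cubes r d δ \ {t : Fin r → Fin d → ℝ | ∀ w : Fin r → Fin d → ℝ,
      (∀ j i, |w j i| = t j i) → ∀ j, GradientDominates f k₁ k₂ (Θ.withWeights w) j} ⊆
      ⋃ j, {t | t ∈ cubes r d δ ∧ t j ∈ B j} := by
    rintro t ⟨htc, hG⟩
    simp only [mem_ofPred_eq, not_forall] at hG
    obtain ⟨w, hw, j, hG⟩ := hG
    have hws : w = fun j i => sg (fun i => decide (0 ≤ w j i)) i * t j i :=
      funext fun j => funext fun i => eq_boolSign_mul (hw j i)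
    rw [hws] at hG
    obtain ⟨l, hl⟩ := H t (cubes_mono r d hδ.2 htc) (fun j i => decide (0 ≤ w j i)) j hG
    exact mem_iUnion.2 ⟨j, htc, mem_iUnion.2 ⟨(_, l), htc j, hl⟩⟩
  have hδ0 : 0 < δ := hδ.1
  calc _ ≤ volume (⋃ j, {t | t ∈ cubes r d δ ∧ t j ∈ B j}) := measure_mono hsub
    _ ≤ ∑ j, volume {t | t ∈ cubes r d δ ∧ t j ∈ B j} := measure_iUnion_fintype_le _ _
    _ ≤ ∑ _j : Fin r, ENNReal.ofReal (η / (r + 1) * δ ^ (r * d)) :=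
        Finset.sum_le_sum fun j _ => volume_cubes_block_le j hδ.1 hη'.le (hvol j)
    _ = ENNReal.ofReal (r * (η / (r + 1) * δ ^ (r * d))) := by
        rw [Finset.sum_const, Finset.card_univ, nsmul_eq_mul,
          ENNReal.ofReal_mul (p := (r : ℝ)) (by positivity), ENNReal.ofReal_natCast,
          Fintype.card_fin]
    _ ≤ ENNReal.ofReal (η * δ ^ (r * d)) := by
        refine ENNReal.ofReal_le_ofReal ?_
        rw [← mul_assoc]
        gcongr
        rw [mul_div_assoc', div_le_iff₀ (by positivity)]
        nlinarith

theorem mainTheorem2 {d r : ℕ} (hd : 0 < d) (Θ : TNNParams d r)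
    (ha : ∀ j, Θ.a j ≠ 0) (hb : ∀ j i, Θ.b j i ≠ 0)
    (k₁ k₂ : Fin d → ℝ) (hk₁ : ∀ i, 0 < k₁ i) (hk₂ : ∀ i, k₁ i < k₂ i)
    (f : (Fin d → ℝ) → ℝ)
    (hf₁ : ∃ z, HasFourierValue f k₁ z) (hf₂ : ∃ z, HasFourierValue f k₂ z)
    (c₁ c₂ : ℝ) (hc₁ : 0 < c₁) (hc₂ : 0 < c₂) :
    -- the inner weights of one neuron are small, all other parameters are fixed
    (∀ j : Fin r,
      (∃ δ₀ > 0, ∀ v : Fin d → ℝ, (∀ i, |v i| ∈ Ioc 0 δ₀) →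
        ‖spectralError f k₁ (Θ.withNeuronWeights j v)‖ > c₁ ∧
        ‖spectralError f k₂ (Θ.withNeuronWeights j v)‖ < c₂) →
      Tendsto (fun δ : ℝ => volume.real
          ({t : Fin d → ℝ | ∀ v : Fin d → ℝ, (∀ i, |v i| = t i) →
              GradientDominates f k₁ k₂ (Θ.withNeuronWeights j v) j} ∩
            {t | ∀ i, t i ∈ Ioc 0 δ}) / δ ^ d)
        (𝓝[>] 0) (𝓝 1)) ∧
    -- the inner weights of all neurons are small simultaneously
    ((∃ δ₀ > 0, ∀ w : Fin r → Fin d → ℝ, (∀ j i, |w j i| ∈ Ioc 0 δ₀) →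
        ‖spectralError f k₁ (Θ.withWeights w)‖ > c₁ ∧
        ‖spectralError f k₂ (Θ.withWeights w)‖ < c₂) →
      Tendsto (fun δ : ℝ => volume.real
          ({t : Fin r → Fin d → ℝ | ∀ w : Fin r → Fin d → ℝ, (∀ j i, |w j i| = t j i) →
              ∀ j, GradientDominates f k₁ k₂ (Θ.withWeights w) j} ∩
            {t | ∀ j i, t j i ∈ Ioc 0 δ}) / δ ^ (r * d))
        (𝓝[>] 0) (𝓝 1)) := by
  refine ⟨fun j => ?_, ?_⟩
  · rintro ⟨δ₀, hδ₀, h⟩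
    exact tendsto_density_gradientDominates_neuron hd Θ j (ha j) (hb j) hk₁ hk₂ f hc₁ hδ₀ h
  · rintro ⟨δ₀, hδ₀, h⟩
    exact tendsto_density_gradientDominates_all hd Θ ha hb hk₁ hk₂ f hc₁ hδ₀ h
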